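/- Let $n\ge 2$ and $0<\alpha<n$. For integers $\ell\ge 0$ let $$\Lambda_\ell=\bigcup_{j\in\mathbb Z}\Big\{(y,s)\in\mathbb R^n\times(0,\infty):\ 2^j\le |s|+|y|<2^{j+1},\ \ 2^{j-\ell}\le |s|-|y|<2^{j-\ell+1}\Big\},$$ and for measurable $f\ge 0$ on $\mathbb R^n\times\mathbb R$ put $$(\Delta_\ell \mathbf I_\alpha f)(x,t)=\iint_{\Lambda_\ell} f(x-y,t-s)\Big(\frac1{|s|+|y|}\Big)^{n-\alpha}\Big(\frac1{|s|-|y|}\Big)^{1-\frac{\alpha}{n}}\,dy\,ds\in[0,\infty].$$ **Lemma of almost orthogonality.** For every $\theta>0$ there is an integer $q_0=q_0(\theta)$ with the following property. Let $q\ge q_0$ be an integer and let $1<p<q$ satisfy $\frac1p-\frac1q\ge\theta$. Then there is $\varepsilon=\varepsilon(p,q)>0$ such that, for every $n\ge2$ and for $\alpha$ given by $\frac{\alpha}{n}=\frac1p-\frac1q$, there is a finite constant $C=C(n,p,q)$ with $$\iint_{\mathbb R^{n+1}}\sum_{\ell=h}^{\infty}(\Delta_\ell \mathbf I_\alpha f)(x,t)\,(\Delta_{\ell-h}\mathbf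 I_\alpha f)^{q-1}(x,t)\,dx\,dt\ \le\ C\,2^{-\varepsilon h}\,\|f\|_{L^p(\mathbb R^{n+1})}^{q}$$ for every measurable $f\ge0$ and every integer $h\ge 0$. In particular, for fixed $\alpha/n\in(0,1)$ the estimate holds for all sufficiently large integers $q$, with $p$ determined by $\frac1p=\frac{\alpha}{n}+\frac1q$; and for fixed $p>1$ it holds for all sufficiently large integers $q$, with $\alpha$ determined by $\frac{\alpha}{n}=\frac1p-\frac1q$. -/

import Mathlib

open MeasureTheory
open scoped ENNReal NNReal

namespace LightCone

/-- The space-time `ℝⁿ × ℝ`, with the Euclidean norm on `ℝⁿ` and Lebesgue (product) measure. -/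
abbrev SpaceTime (n : ℕ) : Type := EuclideanSpace ℝ (Fin n) × ℝ

/-- The truncated region of eccentricity `2 ^ (-ℓ)` at scale `2 ^ j`: the points `(y, s)` with
`s > 0`, `2^j ≤ |s| + |y| < 2^(j+1)` and `2^(j-ℓ) ≤ |s| - |y| < 2^(j-ℓ+1)`. -/
def truncatedCone (n ℓ : ℕ) (j : ℤ) : Set (SpaceTime n) :=
  {w | 0 < w.2 ∧
    (2 : ℝ) ^ j ≤ |w.2| + ‖w.1‖ ∧ |w.2| + ‖w.1‖ < (2 : ℝ) ^ (j + 1) ∧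
    (2 : ℝ) ^ (j - (ℓ : ℤ)) ≤ |w.2| - ‖w.1‖ ∧ |w.2| - ‖w.1‖ < (2 : ℝ) ^ (j - (ℓ : ℤ) + 1)}

/-- The dyadic cone `Λ_ℓ`, the union over `j ∈ ℤ` of the truncated regions. -/
def dyadicCone (n ℓ : ℕ) : Set (SpaceTime n) :=
  ⋃ j : ℤ, truncatedCone n ℓ j

/-- The kernel `(|s| + |y|)^(-(n-α)) (|s| - |y|)^(-(1-α/n))`; it is only used
where `|s| > |y|`. -/
noncomputable def kernel (n : ℕ) (α : ℝ) (w : SpaceTime n) : ℝ :=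
  (1 / (|w.2| + ‖w.1‖)) ^ ((n : ℝ) - α) * (1 / (|w.2| - ‖w.1‖)) ^ (1 - α / (n : ℝ))

/-- The partial operator `Δ_ℓ I_α` applied to a nonnegative function `f`, at `z = (x, t)`: the
integral over `(y, s) ∈ Λ_ℓ` of `f (x - y, t - s)` times the kernel. The kernel is positive on
`Λ_ℓ`, so this is a well-defined element of `[0, ∞]`. -/
noncomputable def partialOp (n : ℕ) (α : ℝ) (ℓ : ℕ) (f : SpaceTime n → ℝ≥0∞)
    (z : SpaceTime n) : ℝ≥0∞ :=
  ∫⁻ w in dyadicCone n ℓ, f (z.1 - w.1, z.2 - w.2) * ENNReal.ofReal (kernel n α w)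

end LightCone

set_option linter.unusedSectionVars false

/-! The almost orthogonality is a consequence of decay for each operator separately: with x = 1/p
and y = 1 - 1/q, so that α/n = x + y - 1, there is τ > 0 with ∫ (Δ_ℓ I_α f) g ≤ C 2^(-τℓ) ‖f‖_p
‖g‖_{q'} (`exists_lintegral_partialOp_mul_le`). Taking g = (Δ_{ℓ-h} I_α f)^(q-1) and bounding this
factor by the L^p → L^q estimate, without its decay, leaves ∑_{ℓ ≥ h} 2^(-τℓ), which is of order
2^(-τh). The argument works for every q, so no largeness of q is needed.

On the piece of Λ_ℓ at scale 2^j the kernel is at most V^(-(1-α/n)), where V = 2^((n+1)j-ℓ) is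
comparable to a bound for the volume of the piece. Young's inequality for the indicator of the piece
costs V^(2-x-y), and the two powers cancel. Two things remain: a gain in ℓ, and summability in j.

The gain comes from the curvature of the light cone. The L² norm of 1_T * f is governed by the
overlaps T ∩ (T - v); for the shell T these are small unless the spatial part of v is short
(`volume_coneShell_overlap_le`), and the exceptional v fill only a thin cylinder. Since n ≥ 2, this
gives `exists_lintegral_sq_coneShell_le`. Interpolating with the trivial bounds carries a power of d
= 2^(-ℓ) to all exponents with x, y < 1 < x + y (`exists_setForm_coneShell_le`).

The sum over j is a real interpolation. At each scale both functions are cut at height 1/V, and the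
single-shell bound is applied to each of the four combinations at slightly perturbed exponents, so
that the series in j become geometric (`exists_tsum_setForm_levelSet_le`). -/

namespace LightCone

/-! ### Convolution with the indicator of a set, as a bilinear form -/

section Form

variable {G : Type*} [AddCommGroup G] [MeasurableSpace G]

/-- The bilinear form `∬ f (z - w) g z 1_S w` attached to a set `S`. -/
noncomputable def setForm (μ : Measure G) (S : Set G) (f g : G → ℝ≥0∞) : ℝ≥0∞ :=
  ∫⁻ z, g z * ∫⁻ w in S, f (z - w) ∂μ ∂μ

variable [MeasurableAdd₂ G] [MeasurableNeg G] {μ : Measure G} [SFinite μ]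
  [μ.IsAddLeftInvariant] [μ.IsNegInvariant]

theorem measurable_comp_sub {f : G → ℝ≥0∞} (hf : Measurable f) :
    Measurable fun p : G × G => f (p.1 - p.2) := by
  simp only [sub_eq_add_neg]
  exact hf.comp (measurable_fst.add measurable_snd.neg)

/-- As one integral over a product measure, the form becomes accessible to Hölder's inequality with
several factors. -/
theorem setForm_eq_lintegral_prod {S : Set G} {f g : G → ℝ≥0∞} (hf : Measurable f)
    (hg : Measurable g) :
    setForm μ S f g = ∫⁻ p, f (p.1 - p.2) * g p.1 ∂(μ.prod (μ.restrict S)) := by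
  rw [lintegral_prod (fun p : G × G => f (p.1 - p.2) * g p.1)
    ((measurable_comp_sub hf).mul (hg.comp measurable_fst)).aemeasurable]
  refine lintegral_congr fun z => ?_
  have : Measurable fun w => f (z - w) :=
    (measurable_comp_sub hf).comp (measurable_const.prodMk measurable_id)
  simp only
  rw [lintegral_mul_const _ this, mul_comm]

theorem setForm_le_mul {S : Set G} {f g : G → ℝ≥0∞} (hg : Measurable g) :
    setForm μ S f g ≤ (∫⁻ z, f z ∂μ) * ∫⁻ z, g z ∂μ := by
  have h (z : G) : g z * ∫⁻ w in S, f (z - w) ∂μ ≤ g z * ∫⁻ w, f w ∂μ := by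
    refine mul_le_mul_right ?_ _
    refine (setLIntegral_le_lintegral _ _).trans ?_
    rw [lintegral_sub_left_eq_self]
  refine (lintegral_mono h).trans ?_
  rw [lintegral_mul_const _ hg, mul_comm]

theorem lintegral_prod_restrict_sub {S : Set G} {f : G → ℝ≥0∞} (hf : Measurable f) :
    ∫⁻ p, f (p.1 - p.2) ∂(μ.prod (μ.restrict S)) = (∫⁻ z, f z ∂μ) * μ S := by
  rw [lintegral_prod_symm _ (measurable_comp_sub hf).aemeasurable]
  simp [lintegral_sub_right_eq_self f]

theorem lintegral_prod_restrict_fst {S : Set G} {g : G → ℝ≥0∞} (hg : Measurable g) :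
    ∫⁻ p, g p.1 ∂(μ.prod (μ.restrict S)) = (∫⁻ z, g z ∂μ) * μ S := by
  rw [lintegral_prod (fun p : G × G => g p.1) (hg.comp measurable_fst).aemeasurable]
  simp [lintegral_mul_const _ hg]

/-- Interpolation between the three trivial bounds of `setForm` and a fourth one. -/
theorem setForm_rpow_le_interpolation {S : Set G} {f g : G → ℝ≥0∞} (hf : Measurable f)
    (hg : Measurable g) {a b c d u v : ℝ} (ha : 0 ≤ a) (hb : 0 ≤ b) (hc : 0 ≤ c) (hd : 0 ≤ d)
    (hu : 0 ≤ u) (hv : 0 ≤ v) (hsum : a + b + c + d = 1) :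
    setForm μ S (fun z => f z ^ (a + b + u * d)) (fun z => g z ^ (a + c + v * d)) ≤
      ((∫⁻ z, f z ∂μ) * ∫⁻ z, g z ∂μ) ^ a * ((∫⁻ z, f z ∂μ) * μ S) ^ b *
        ((∫⁻ z, g z ∂μ) * μ S) ^ c *
        (setForm μ S (fun z => f z ^ u) (fun z => g z ^ v)) ^ d := by
  rw [setForm_eq_lintegral_prod (hf.pow_const _) (hg.pow_const _),
    setForm_eq_lintegral_prod (hf.pow_const _) (hg.pow_const _)]
  have hf2 := measurable_comp_sub hf
  have hg1 : Measurable fun p : G × G => g p.1 := hg.comp measurable_fst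
  let F : Fin 4 → G × G → ℝ≥0∞ := ![fun p => f (p.1 - p.2) * g p.1, fun p => f (p.1 - p.2),
    fun p => g p.1, fun p => f (p.1 - p.2) ^ u * g p.1 ^ v]
  let e : Fin 4 → ℝ := ![a, b, c, d]
  have key := ENNReal.lintegral_prod_norm_pow_le (μ := μ.prod (μ.restrict S)) Finset.univ
    (f := F) (p := e) ?_ ?_ ?_
  · have h1 : ∫⁻ p, f (p.1 - p.2) * g p.1 ∂(μ.prod (μ.restrict S)) ≤
        (∫⁻ z, f z ∂μ) * ∫⁻ z, g z ∂μ := by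
      rw [← setForm_eq_lintegral_prod hf hg]
      exact setForm_le_mul hg
    simp only [Fin.prod_univ_four, F, e, Matrix.cons_val_zero, Matrix.cons_val_one,
      Matrix.cons_val] at key
    rw [lintegral_prod_restrict_sub hf, lintegral_prod_restrict_fst hg] at key
    refine (le_of_eq ?_).trans (key.trans (by gcongr))
    refine lintegral_congr fun p => ?_
    rw [ENNReal.mul_rpow_of_nonneg _ _ ha, ENNReal.mul_rpow_of_nonneg _ _ hd,
      ← ENNReal.rpow_mul, ← ENNReal.rpow_mul,
      ENNReal.rpow_add_of_nonneg _ _ (add_nonneg ha hb) (mul_nonneg hu hd),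
      ENNReal.rpow_add_of_nonneg _ _ ha hb,
      ENNReal.rpow_add_of_nonneg _ _ (add_nonneg ha hc) (mul_nonneg hv hd),
      ENNReal.rpow_add_of_nonneg _ _ ha hc]
    ring
  · intro i _
    fin_cases i
    · exact (hf2.mul hg1).aemeasurable
    · exact hf2.aemeasurable
    · exact hg1.aemeasurable
    · exact ((hf2.pow_const _).mul (hg1.pow_const _)).aemeasurable
  · simpa [Fin.sum_univ_four, e] using hsum
  · intro i _
    fin_cases i <;> assumption

/-- Young's inequality for the indicator function of a set. -/
theorem setForm_rpow_le_young {S : Set G} {f g : G → ℝ≥0∞} (hf : Measurable f)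
    (hg : Measurable g) {x y : ℝ} (hx : x ≤ 1) (hy : y ≤ 1) (hxy : 1 ≤ x + y) :
    setForm μ S (fun z => f z ^ x) (fun z => g z ^ y) ≤
      (∫⁻ z, f z ∂μ) ^ x * (∫⁻ z, g z ∂μ) ^ y * μ S ^ (2 - x - y) := by
  -- With `d = 0` the fourth bound drops out, and these are the only weights that produce the
  -- exponents `x` and `y`.
  have h := setForm_rpow_le_interpolation (μ := μ) (S := S) hf hg (a := x + y - 1) (b := 1 - y)
    (c := 1 - x) (d := 0) (u := 0) (v := 0) (by linarith) (by linarith) (by linarith) le_rfl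
    le_rfl le_rfl (by ring)
  have e1 : x + y - 1 + (1 - y) + 0 * 0 = x := by ring
  have e2 : x + y - 1 + (1 - x) + 0 * 0 = y := by ring
  rw [e1, e2, ENNReal.rpow_zero, mul_one, ENNReal.mul_rpow_of_nonneg _ _ (by linarith),
    ENNReal.mul_rpow_of_nonneg _ _ (by linarith), ENNReal.mul_rpow_of_nonneg _ _ (by linarith)] at h
  refine h.trans (le_of_eq ?_)
  have e3 : (∫⁻ z, f z ∂μ) ^ x = (∫⁻ z, f z ∂μ) ^ (x + y - 1) * (∫⁻ z, f z ∂μ) ^ (1 - y) := by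
    rw [← ENNReal.rpow_add_of_nonneg _ _ (by linarith) (by linarith)]; congr 1; ring
  have e4 : (∫⁻ z, g z ∂μ) ^ y = (∫⁻ z, g z ∂μ) ^ (x + y - 1) * (∫⁻ z, g z ∂μ) ^ (1 - x) := by
    rw [← ENNReal.rpow_add_of_nonneg _ _ (by linarith) (by linarith)]; congr 1; ring
  have e5 : μ S ^ (2 - x - y) = μ S ^ (1 - y) * μ S ^ (1 - x) := by
    rw [← ENNReal.rpow_add_of_nonneg _ _ (by linarith) (by linarith)]; congr 1; ring
  rw [e3, e4, e5]
  ring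

/-- The square of the `L²` norm of `1_T * f`, expressed by the overlaps of the translates of
`T`. -/
theorem lintegral_sq_setLIntegral_sub {T : Set G} (hT : MeasurableSet T) {f : G → ℝ≥0∞}
    (hf : Measurable f) :
    ∫⁻ z, (∫⁻ w in T, f (z - w) ∂μ) ^ 2 ∂μ =
      ∫⁻ v, μ {w | w ∈ T ∧ w + v ∈ T} * ∫⁻ z, f z * f (z - v) ∂μ ∂μ := by
  have hsub : Measurable fun p : G × G => f (p.1 - p.2) := measurable_comp_sub hf
  have hI : Measurable (T.indicator (1 : G → ℝ≥0∞)) := measurable_one.indicator hT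
  let χ : G → ℝ≥0∞ := T.indicator 1
  -- The square is a double integral over pairs of points of `T`; the second point is written `w +
  -- v`, so that `v` is their difference.
  have h1 (z : G) : (∫⁻ w in T, f (z - w) ∂μ) ^ 2 =
      ∫⁻ w, ∫⁻ v, χ w * f (z - w) * (χ (w + v) * f (z - (w + v))) ∂μ ∂μ := by
    have e : ∫⁻ w in T, f (z - w) ∂μ = ∫⁻ w, χ w * f (z - w) ∂μ := by
      rw [← lintegral_indicator hT]
      refine lintegral_congr fun w => ?_
      by_cases hw : w ∈ T <;> simp [χ, hw]
    have hm : Measurable fun w => χ w * f (z - w) :=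
      hI.mul (hsub.comp (measurable_const.prodMk measurable_id))
    have e' (w : G) : ∫⁻ v, χ w * f (z - w) * (χ (w + v) * f (z - (w + v))) ∂μ =
        (χ w * f (z - w)) * ∫⁻ v, χ v * f (z - v) ∂μ := by
      rw [lintegral_const_mul (f := fun v => χ (w + v) * f (z - (w + v))) _
        (hm.comp (measurable_const_add w))]
      rw [lintegral_add_left_eq_self (fun v => χ v * f (z - v)) w]
    simp_rw [e']
    rw [lintegral_mul_const _ hm, e, sq]
  have mχ : Measurable χ := hI
  have m1 {H : Type _} [MeasurableSpace H] {a b : H → G} (ha : Measurable a)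
      (hb : Measurable b) : Measurable fun q => f (a q - b q) :=
    hsub.comp (f := fun q => (a q, b q)) (ha.prodMk hb)
  have hfull : Measurable fun r : (G × G) × G => χ r.1.2 * f (r.1.1 - r.1.2) *
      (χ (r.1.2 + r.2) * f (r.1.1 - (r.1.2 + r.2))) :=
    ((mχ.comp (by fun_prop)).mul (m1 (by fun_prop) (by fun_prop))).mul
      ((mχ.comp (by fun_prop)).mul (m1 (by fun_prop) (by fun_prop)))
  simp_rw [h1]
  rw [lintegral_lintegral_swap (hfull.lintegral_prod_right' (ν := μ)).aemeasurable]
  have hA : Measurable fun v => ∫⁻ z, f z * f (z - v) ∂μ := by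
    refine Measurable.lintegral_prod_right' (f := fun q : G × G => f q.2 * f (q.2 - q.1)) ?_
    exact (hf.comp measurable_snd).mul (m1 measurable_snd measurable_fst)
  have h2 (w : G) : ∫⁻ z, ∫⁻ v, χ w * f (z - w) * (χ (w + v) * f (z - (w + v))) ∂μ ∂μ =
      ∫⁻ v, χ w * χ (w + v) * ∫⁻ z, f z * f (z - v) ∂μ ∂μ := by
    have hw : Measurable fun q : G × G => χ w * f (q.1 - w) * (χ (w + q.2) * f (q.1 - (w + q.2))) :=
      hfull.comp (g := fun r : (G × G) × G => χ r.1.2 * f (r.1.1 - r.1.2) *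
        (χ (r.1.2 + r.2) * f (r.1.1 - (r.1.2 + r.2)))) (f := fun q : G × G => ((q.1, w), q.2))
        (by fun_prop)
    rw [lintegral_lintegral_swap hw.aemeasurable]
    refine lintegral_congr fun v => ?_
    rw [← lintegral_sub_right_eq_self (fun z => f z * f (z - v)) w, ← lintegral_const_mul]
    · refine lintegral_congr fun z => ?_
      rw [sub_add_eq_sub_sub]
      ring
    · exact (m1 measurable_id measurable_const).mul
        (m1 (measurable_id.sub_const w) measurable_const)
  simp_rw [h2]
  have h3 : Measurable fun q : G × G => χ q.1 * χ (q.1 + q.2) * ∫⁻ z, f z * f (z - q.2) ∂μ :=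
    ((mχ.comp measurable_fst).mul (mχ.comp (by fun_prop))).mul (hA.comp measurable_snd)
  rw [lintegral_lintegral_swap h3.aemeasurable]
  refine lintegral_congr fun v => ?_
  have h4 : Measurable fun w => χ w * χ (w + v) := mχ.mul (mχ.comp (measurable_add_const v))
  rw [lintegral_mul_const _ h4]
  congr 1
  have h5 : MeasurableSet {w | w ∈ T ∧ w + v ∈ T} := hT.inter (measurable_add_const v hT)
  rw [← lintegral_indicator_one h5]
  refine lintegral_congr fun w => ?_
  by_cases hw : w ∈ T <;> by_cases hwv : w + v ∈ T <;> simp [χ, hw, hwv]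

end Form

/-! ### Curvature of the norm and level sets of `‖y + a‖ - ‖y‖` -/

theorem hasDerivAt_sqrt_sq_add {B : ℝ} (hB : 0 < B) (t : ℝ) :
    HasDerivAt (fun t : ℝ => √(t ^ 2 + B)) (t / √(t ^ 2 + B)) t := by
  have h : HasDerivAt (fun t : ℝ => t ^ 2 + B) (2 * t) t := by
    simpa using (hasDerivAt_pow 2 t).add_const B
  have hpos : t ^ 2 + B ≠ 0 := by positivity
  convert h.sqrt hpos using 1
  field_simp

theorem hasDerivAt_div_sqrt_sq_add {B : ℝ} (hB : 0 < B) (t : ℝ) :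
    HasDerivAt (fun t : ℝ => t / √(t ^ 2 + B)) (B / √(t ^ 2 + B) ^ 3) t := by
  have hpos : 0 < t ^ 2 + B := by positivity
  have hs : 0 < √(t ^ 2 + B) := Real.sqrt_pos.2 hpos
  have h2 : √(t ^ 2 + B) ^ 2 = t ^ 2 + B := Real.sq_sqrt hpos.le
  have h3 : B / √(t ^ 2 + B) ^ 3 =
      (1 * √(t ^ 2 + B) - t * (t / √(t ^ 2 + B))) / √(t ^ 2 + B) ^ 2 := by
    field_simp
    linear_combination -h2
  rw [h3]
  exact (hasDerivAt_id t).div (hasDerivAt_sqrt_sq_add hB t) hs.ne'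

theorem sq_add_le_of_sqrt_le {B R t : ℝ} (hB : 0 ≤ B) (h : √(t ^ 2 + B) ≤ R) :
    t ^ 2 + B ≤ R ^ 2 := by
  have := Real.sqrt_nonneg (t ^ 2 + B)
  rw [← Real.sq_sqrt (by positivity : 0 ≤ t ^ 2 + B)]
  gcongr

theorem sq_le_max_of_mem_Icc {s t r : ℝ} (h : r ∈ Set.Icc s t) :
    r ^ 2 ≤ max (s ^ 2) (t ^ 2) := by
  obtain ⟨h1, h2⟩ := h
  rcases le_total 0 r with h0 | h0
  · exact le_max_of_le_right (by nlinarith)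
  · exact le_max_of_le_left (by nlinarith)

/-- This is the uniform convexity of `√(t² + B)`: its second derivative `B / (t² + B)^(3/2)` is at
least `B / R³` on the interval. -/
theorem mul_sub_le_div_sqrt_sub {B R s t : ℝ} (hB : 0 < B) (hst : s ≤ t)
    (hs : s ^ 2 + B ≤ R ^ 2) (ht : t ^ 2 + B ≤ R ^ 2) (hR : 0 < R) :
    B / R ^ 3 * (t - s) ≤ t / √(t ^ 2 + B) - s / √(s ^ 2 + B) := by
  refine (convex_Icc s t).mul_sub_le_image_sub_of_le_deriv
    (f := fun t : ℝ => t / √(t ^ 2 + B)) ?_ ?_ ?_ s (by simp [hst]) t (by simp [hst]) hst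
  · exact fun r _ => (hasDerivAt_div_sqrt_sq_add hB r).continuousAt.continuousWithinAt
  · exact fun r _ => (hasDerivAt_div_sqrt_sq_add hB r).differentiableAt.differentiableWithinAt
  · intro r hr
    rw [(hasDerivAt_div_sqrt_sq_add hB r).deriv]
    have h1 := sq_le_max_of_mem_Icc (interior_subset hr)
    have h2 : r ^ 2 + B ≤ R ^ 2 := by
      rcases le_max_iff.1 h1 with h | h <;> linarith
    have h3 : √(r ^ 2 + B) ≤ R := Real.sqrt_le_iff.2 ⟨hR.le, h2⟩
    have h4 : 0 < √(r ^ 2 + B) := Real.sqrt_pos.2 (by positivity)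
    gcongr

/-- The function `u ↦ |(u + ρ, z)| - |(u, z)|` grows at least linearly. -/
theorem mul_sub_le_sqrt_diff {B R ρ u v : ℝ} (hB : 0 < B) (hR : 0 < R) (hρ : 0 < ρ) (huv : u ≤ v)
    (h1 : √(u ^ 2 + B) ≤ R) (h2 : √((u + ρ) ^ 2 + B) ≤ R)
    (h3 : √(v ^ 2 + B) ≤ R) (h4 : √((v + ρ) ^ 2 + B) ≤ R) :
    B / R ^ 3 * ρ * (v - u) ≤ (√((v + ρ) ^ 2 + B) - √(v ^ 2 + B)) -
      (√((u + ρ) ^ 2 + B) - √(u ^ 2 + B)) := by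
  replace h1 := sq_add_le_of_sqrt_le hB.le h1
  replace h2 := sq_add_le_of_sqrt_le hB.le h2
  replace h3 := sq_add_le_of_sqrt_le hB.le h3
  replace h4 := sq_add_le_of_sqrt_le hB.le h4
  have hd (r : ℝ) : HasDerivAt (fun r : ℝ => √((r + ρ) ^ 2 + B) - √(r ^ 2 + B))
      ((r + ρ) / √((r + ρ) ^ 2 + B) - r / √(r ^ 2 + B)) r :=
    ((hasDerivAt_sqrt_sq_add hB (r + ρ)).comp_add_const r ρ).sub (hasDerivAt_sqrt_sq_add hB r)
  refine (convex_Icc u v).mul_sub_le_image_sub_of_le_deriv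
    (f := fun r : ℝ => √((r + ρ) ^ 2 + B) - √(r ^ 2 + B)) ?_ ?_ ?_ u (by simp [huv]) v
    (by simp [huv]) huv
  · exact fun r _ => (hd r).continuousAt.continuousWithinAt
  · exact fun r _ => (hd r).differentiableAt.differentiableWithinAt
  · intro r hr
    rw [(hd r).deriv]
    have hr' := interior_subset hr
    have h5 : r ^ 2 + B ≤ R ^ 2 := by
      rcases le_max_iff.1 (sq_le_max_of_mem_Icc hr') with h | h <;> linarith
    have h6 : (r + ρ) ^ 2 + B ≤ R ^ 2 := by
      have : r + ρ ∈ Set.Icc (u + ρ) (v + ρ) := ⟨by linarith [hr'.1], by linarith [hr'.2]⟩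
      rcases le_max_iff.1 (sq_le_max_of_mem_Icc this) with h | h <;> linarith
    have := mul_sub_le_div_sqrt_sub hB (by linarith : r ≤ r + ρ) h5 h6 hR
    rwa [add_sub_cancel_left] at this

/-- The difference of norms increases at rate at least `Bρ / R³` between points of the set, so
confining it to an interval of length `2m` bounds the diameter of the set. -/
theorem volume_sqrt_diff_le {B R ρ m c : ℝ} (hB : 0 < B) (hR : 0 < R) (hρ : 0 < ρ) :
    volume {u : ℝ | √(u ^ 2 + B) ≤ R ∧ √((u + ρ) ^ 2 + B) ≤ R ∧
      |√((u + ρ) ^ 2 + B) - √(u ^ 2 + B) - c| ≤ m} ≤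
      ENNReal.ofReal (2 * m * R ^ 3 / (ρ * B)) := by
  refine (Real.volume_le_diam _).trans (Metric.ediam_le ?_)
  have key : ∀ u v : ℝ, u ≤ v → √(u ^ 2 + B) ≤ R → √((u + ρ) ^ 2 + B) ≤ R →
      |√((u + ρ) ^ 2 + B) - √(u ^ 2 + B) - c| ≤ m → √(v ^ 2 + B) ≤ R → √((v + ρ) ^ 2 + B) ≤ R →
      |√((v + ρ) ^ 2 + B) - √(v ^ 2 + B) - c| ≤ m → v - u ≤ 2 * m * R ^ 3 / (ρ * B) := by
    intro u v huv h1 h2 h3 h4 h5 h6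
    have h := mul_sub_le_sqrt_diff hB hR hρ huv h1 h2 h4 h5
    rw [abs_le] at h3 h6
    rw [le_div_iff₀ (by positivity)]
    have : B / R ^ 3 * ρ * (v - u) ≤ 2 * m := by linarith [h3.1, h6.2]
    calc (v - u) * (ρ * B) = B / R ^ 3 * ρ * (v - u) * R ^ 3 := by field_simp
      _ ≤ 2 * m * R ^ 3 := by gcongr
  rintro u ⟨h1, h2, h3⟩ v ⟨h4, h5, h6⟩
  rw [edist_dist, Real.dist_eq]
  refine ENNReal.ofReal_le_ofReal ?_
  rcases le_total u v with h | h
  · rw [abs_sub_comm, abs_of_nonneg (by linarith)]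
    exact key u v h h1 h2 h3 h4 h5 h6
  · rw [abs_of_nonneg (by linarith)]
    exact key v u h h4 h5 h6 h1 h2 h3

/-- The one-dimensional bound is integrated over the lines parallel to the first axis. It
degenerates for lines close to that axis, so the slab where the first transverse coordinate is at
most `β` is removed and estimated by its volume. -/
theorem volume_prod_sqrt_diff_le (k : ℕ) {R ρ m c β : ℝ} (hR : 0 < R) (hρ : 0 < ρ) (hm : 0 ≤ m)
    (hβ : 0 < β) :
    volume {p : ℝ × (Fin (k + 1) → ℝ) | √(p.1 ^ 2 + ∑ i, p.2 i ^ 2) ≤ R ∧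
      √((p.1 + ρ) ^ 2 + ∑ i, p.2 i ^ 2) ≤ R ∧
      |√((p.1 + ρ) ^ 2 + ∑ i, p.2 i ^ 2) - √(p.1 ^ 2 + ∑ i, p.2 i ^ 2) - c| ≤ m} ≤
      ENNReal.ofReal ((2 * R) ^ (k + 1) * (2 * β + 2 * m * R ^ 3 / (ρ * β ^ 2))) := by
  set Q : Set (ℝ × (Fin (k + 1) → ℝ)) := {p | √(p.1 ^ 2 + ∑ i, p.2 i ^ 2) ≤ R ∧
      √((p.1 + ρ) ^ 2 + ∑ i, p.2 i ^ 2) ≤ R ∧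
      |√((p.1 + ρ) ^ 2 + ∑ i, p.2 i ^ 2) - √(p.1 ^ 2 + ∑ i, p.2 i ^ 2) - c| ≤ m} with hQ
  have hQm : MeasurableSet Q := by
    apply IsClosed.measurableSet
    simp only [hQ, Set.ofPred_and]
    refine (isClosed_le (by fun_prop) (by fun_prop)).inter
      ((isClosed_le (by fun_prop) (by fun_prop)).inter (isClosed_le (by fun_prop) (by fun_prop)))
  let K : ℝ → Set (Fin (k + 1) → ℝ) := fun r =>
    Set.pi Set.univ (Fin.cons (Set.Icc (-r) r) fun _ => Set.Icc (-R) R)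
  have hK (r : ℝ) (hr : 0 ≤ r) : volume (K r) = ENNReal.ofReal (2 * r * (2 * R) ^ k) := by
    simp only [K]
    rw [volume_pi_pi, Fin.prod_univ_succ]
    simp only [Fin.cons_zero, Fin.cons_succ, Real.volume_Icc, Finset.prod_const, Finset.card_univ,
      Fintype.card_fin]
    rw [ENNReal.ofReal_mul (by positivity), ENNReal.ofReal_pow (by positivity)]
    congr <;> ring
  have hKm (r : ℝ) : MeasurableSet (K r) := by
    refine MeasurableSet.univ_pi fun i => ?_
    refine Fin.cases ?_ (fun i => ?_) i
    · exact measurableSet_Icc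
    · exact measurableSet_Icc
  have hcoord (p : ℝ × (Fin (k + 1) → ℝ)) (hp : p ∈ Q) : p.1 ∈ Set.Icc (-R) R ∧
      ∀ i, p.2 i ∈ Set.Icc (-R) R := by
    have h := sq_add_le_of_sqrt_le (Finset.sum_nonneg fun i _ => sq_nonneg (p.2 i)) hp.1
    have hs : 0 ≤ ∑ i, p.2 i ^ 2 := Finset.sum_nonneg fun i _ => sq_nonneg (p.2 i)
    refine ⟨abs_le.1 (abs_le_of_sq_le_sq (by linarith) hR.le), fun i => ?_⟩
    have hi := Finset.single_le_sum (f := fun i => p.2 i ^ 2) (fun i _ => sq_nonneg (p.2 i))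
      (Finset.mem_univ i)
    refine abs_le.1 (abs_le_of_sq_le_sq ?_ hR.le)
    nlinarith [sq_nonneg p.1]
  have hsplit : Q ⊆ (Set.Icc (-R) R ×ˢ K β) ∪ (Q ∩ {p | β ≤ |p.2 0|}) := by
    intro p hp
    obtain ⟨h1, h2⟩ := hcoord p hp
    rcases le_total β |p.2 0| with h | h
    · exact Or.inr ⟨hp, h⟩
    · refine Or.inl ⟨h1, fun i _ => ?_⟩
      refine Fin.cases ?_ (fun i => ?_) i
      · exact abs_le.1 h
      · exact h2 _
  have hfirst : volume (Set.Icc (-R) R ×ˢ K β) = ENNReal.ofReal ((2 * R) ^ (k + 1) * (2 * β)) := by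
    rw [Measure.volume_eq_prod, Measure.prod_prod, hK β hβ.le, Real.volume_Icc,
      ← ENNReal.ofReal_mul (by linarith)]
    congr 1
    ring
  have hsecond : volume (Q ∩ {p | β ≤ |p.2 0|}) ≤
      ENNReal.ofReal ((2 * R) ^ (k + 1) * (2 * m * R ^ 3 / (ρ * β ^ 2))) := by
    have hm2 : MeasurableSet (Q ∩ {p : ℝ × (Fin (k + 1) → ℝ) | β ≤ |p.2 0|}) :=
      hQm.inter (isClosed_le (by fun_prop) (by fun_prop)).measurableSet
    rw [Measure.volume_eq_prod, Measure.prod_apply_symm hm2]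
    have hsl (z : Fin (k + 1) → ℝ) :
        volume ((fun u => (u, z)) ⁻¹' (Q ∩ {p : ℝ × (Fin (k + 1) → ℝ) | β ≤ |p.2 0|})) ≤
        (K R).indicator (fun _ => ENNReal.ofReal (2 * m * R ^ 3 / (ρ * β ^ 2))) z := by
      by_cases hne : ((fun u => (u, z)) ⁻¹'
        (Q ∩ {p : ℝ × (Fin (k + 1) → ℝ) | β ≤ |p.2 0|})).Nonempty
      · obtain ⟨u, hu, hβz⟩ := hne
        simp only [Set.mem_ofPred_eq] at hβz
        have hz : z ∈ K R := by
          refine fun i _ => ?_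
          refine Fin.cases ?_ (fun i => ?_) i
          · exact (hcoord _ hu).2 0
          · exact (hcoord _ hu).2 _
        rw [Set.indicator_of_mem hz]
        have hB : β ^ 2 ≤ ∑ i, z i ^ 2 := by
          refine le_trans ?_ (Finset.single_le_sum (f := fun i => z i ^ 2)
            (fun i _ => sq_nonneg (z i)) (Finset.mem_univ 0))
          rw [← sq_abs (z 0)]
          gcongr
        have hB0 : 0 < ∑ i, z i ^ 2 := lt_of_lt_of_le (by positivity) hB
        refine (measure_mono ?_).trans
          ((volume_sqrt_diff_le (m := m) (c := c) hB0 hR hρ).trans ?_)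
        · exact fun u hu => hu.1
        · refine ENNReal.ofReal_le_ofReal ?_
          gcongr
      · rw [Set.not_nonempty_iff_eq_empty.1 hne]
        simp
    refine (lintegral_mono hsl).trans ?_
    rw [lintegral_indicator_const (hKm R), hK R hR.le, ← ENNReal.ofReal_mul (by positivity)]
    refine le_of_eq ?_
    congr 1
    ring
  calc volume Q ≤ volume (Set.Icc (-R) R ×ˢ K β) + volume (Q ∩ {p | β ≤ |p.2 0|}) :=
        (measure_mono hsplit).trans (measure_union_le _ _)
    _ ≤ ENNReal.ofReal ((2 * R) ^ (k + 1) * (2 * β)) +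
        ENNReal.ofReal ((2 * R) ^ (k + 1) * (2 * m * R ^ 3 / (ρ * β ^ 2))) := by
        rw [hfirst]; gcongr
    _ = _ := by
        rw [← ENNReal.ofReal_add (by positivity) (by positivity), mul_add]

/-- A rotation takes `a` to the first axis. Dimension `k + 2` guarantees a transverse direction,
without which there is no curvature. -/
theorem volume_norm_diff_le (k : ℕ) {R m c β : ℝ} (hR : 0 < R) (hm : 0 ≤ m)
    (hβ : 0 < β) {a : EuclideanSpace ℝ (Fin (k + 2))} (ha : a ≠ 0) :
    volume {y : EuclideanSpace ℝ (Fin (k + 2)) | ‖y‖ ≤ R ∧ ‖y + a‖ ≤ R ∧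
      |‖y + a‖ - ‖y‖ - c| ≤ m} ≤
      ENNReal.ofReal ((2 * R) ^ (k + 1) * (2 * β + 2 * m * R ^ 3 / (‖a‖ * β ^ 2))) := by
  have hρ : 0 < ‖a‖ := norm_pos_iff.2 ha
  obtain ⟨b, hb⟩ : ∃ b : OrthonormalBasis (Fin (k + 2)) ℝ (EuclideanSpace ℝ (Fin (k + 2))),
      b 0 = (‖a‖⁻¹ : ℝ) • a := by
    obtain ⟨b, hb⟩ := Orthonormal.exists_orthonormalBasis_extension_of_card_eq (𝕜 := ℝ)
      (E := EuclideanSpace ℝ (Fin (k + 2))) (ι := Fin (k + 2)) (by simp)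
      (v := fun _ => (‖a‖⁻¹ : ℝ) • a) (s := {0}) (by
        constructor
        · intro i
          simp [norm_smul, hρ.ne']
        · intro i j hij
          exact absurd (Subsingleton.elim i j) hij)
    exact ⟨b, hb 0 rfl⟩
  let e1 := b.measurePreserving_repr
  let e2 := EuclideanSpace.volume_preserving_symm_measurableEquiv_toLp (Fin (k + 2))
  let e3 := volume_preserving_piFinSuccAbove (fun _ : Fin (k + 2) => ℝ) 0
  have ha0 (i : Fin (k + 1)) : b.repr a i.succ = 0 := by
    have : a = ‖a‖ • b 0 := by rw [hb, smul_smul, mul_inv_cancel₀ hρ.ne', one_smul]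
    rw [this, map_smul]
    simp
  have ha1 : b.repr a 0 = ‖a‖ := by
    have : a = ‖a‖ • b 0 := by rw [hb, smul_smul, mul_inv_cancel₀ hρ.ne', one_smul]
    conv_lhs => rw [this, map_smul]
    simp
  have hnorm (y : EuclideanSpace ℝ (Fin (k + 2))) :
      ‖y‖ = √(b.repr y 0 ^ 2 + ∑ i : Fin (k + 1), b.repr y i.succ ^ 2) := by
    rw [← b.repr.norm_map y, EuclideanSpace.norm_eq, Fin.sum_univ_succ]
    simp
  have hnorm2 (y : EuclideanSpace ℝ (Fin (k + 2))) :
      ‖y + a‖ = √((b.repr y 0 + ‖a‖) ^ 2 + ∑ i : Fin (k + 1), b.repr y i.succ ^ 2) := by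
    rw [hnorm (y + a)]
    simp [ha0, ha1]
  have hmain := volume_prod_sqrt_diff_le k (c := c) hR hρ hm hβ
  refine le_trans ?_ hmain
  have hcomp := (e3.comp e2).comp e1
  refine le_trans (le_of_eq ?_) (hcomp.measure_preimage_le _)
  congr 1
  ext y
  simp only [Set.mem_ofPred_eq, Set.mem_preimage, hnorm2, Function.comp]
  rw [hnorm y]
  rfl

/-! ### Volumes of shells and of their overlaps -/

instance (n : ℕ) : (volume : Measure (SpaceTime n)).IsAddHaarMeasure :=
  inferInstanceAs (((volume : Measure (EuclideanSpace ℝ (Fin n))).prod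
    (volume : Measure ℝ)).IsAddHaarMeasure)

instance (n : ℕ) : (volume : Measure (SpaceTime n)).IsNegInvariant :=
  inferInstance

/-- The part of a neighbourhood of the light cone at scale `R` with eccentricity `d`. -/
def coneShell (n : ℕ) (R d : ℝ) : Set (SpaceTime n) :=
  {w | 0 < w.2 ∧ R ≤ |w.2| + ‖w.1‖ ∧ |w.2| + ‖w.1‖ < 2 * R ∧
    R * d ≤ |w.2| - ‖w.1‖ ∧ |w.2| - ‖w.1‖ < 2 * (R * d)}

theorem truncatedCone_eq_coneShell (n l : ℕ) (j : ℤ) :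
    truncatedCone n l j = coneShell n ((2 : ℝ) ^ j) ((2 : ℝ) ^ (-(l : ℝ))) := by
  have h1 : (2 : ℝ) ^ (j + 1) = 2 * 2 ^ j := by rw [zpow_add_one₀ two_ne_zero, mul_comm]
  have h2 : (2 : ℝ) ^ (j - (l : ℤ)) = 2 ^ j * (2 : ℝ) ^ (-(l : ℝ)) := by
    rw [zpow_sub₀ two_ne_zero, Real.rpow_neg two_pos.le]
    simp [div_eq_mul_inv]
  have h3 : (2 : ℝ) ^ (j - (l : ℤ) + 1) = 2 * (2 ^ j * (2 : ℝ) ^ (-(l : ℝ))) := by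
    rw [zpow_add_one₀ two_ne_zero, h2, mul_comm]
  simp only [truncatedCone, coneShell, h1, h2, h3]

theorem measurableSet_coneShell (n : ℕ) (R d : ℝ) : MeasurableSet (coneShell n R d) := by
  simp only [coneShell, Set.ofPred_and]
  refine (measurableSet_lt ?_ ?_).inter ((measurableSet_le ?_ ?_).inter ((measurableSet_lt ?_ ?_).inter
    ((measurableSet_le ?_ ?_).inter (measurableSet_lt ?_ ?_)))) <;> fun_prop

/-- The fibre over each `y ∈ A` is an interval of length `a` in time; shells and their overlaps are
contained in sets of this form. -/
theorem volume_shear_le {n : ℕ} {A : Set (EuclideanSpace ℝ (Fin n))} (hA : MeasurableSet A)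
    (a : ℝ) :
    volume {w : SpaceTime n | w.1 ∈ A ∧ ‖w.1‖ + a ≤ w.2 ∧ w.2 < ‖w.1‖ + 2 * a} ≤
      volume A * ENNReal.ofReal a := by
  have hm : MeasurableSet {w : SpaceTime n | w.1 ∈ A ∧ ‖w.1‖ + a ≤ w.2 ∧ w.2 < ‖w.1‖ + 2 * a} := by
    simp only [Set.ofPred_and]
    refine (measurable_fst hA).inter ((measurableSet_le ?_ ?_).inter (measurableSet_lt ?_ ?_)) <;>
      fun_prop
  rw [Measure.volume_eq_prod, Measure.prod_apply hm]
  have h (y : EuclideanSpace ℝ (Fin n)) : volume (Prod.mk y ⁻¹'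
      {w : SpaceTime n | w.1 ∈ A ∧ ‖w.1‖ + a ≤ w.2 ∧ w.2 < ‖w.1‖ + 2 * a}) ≤
      A.indicator (fun _ => ENNReal.ofReal a) y := by
    by_cases hy : y ∈ A
    · rw [Set.indicator_of_mem hy]
      refine (measure_mono (t := Set.Ico (‖y‖ + a) (‖y‖ + 2 * a)) fun s hs => hs.2).trans ?_
      rw [Real.volume_Ico]
      exact ENNReal.ofReal_le_ofReal (by linarith)
    · have : Prod.mk y ⁻¹' {w : SpaceTime n | w.1 ∈ A ∧ ‖w.1‖ + a ≤ w.2 ∧ w.2 < ‖w.1‖ + 2 * a} =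
          ∅ := by
        ext s
        simp [hy]
      simp [this]
  refine (lintegral_mono h).trans ?_
  rw [lintegral_indicator_const hA, mul_comm]

theorem norm_le_of_mem_coneShell {n : ℕ} {R d : ℝ} (hR : 0 < R) (hd : 0 < d) {w : SpaceTime n}
    (hw : w ∈ coneShell n R d) : ‖w.1‖ ≤ R ∧ 0 < w.2 ∧ w.2 ≤ 2 * R ∧ ‖w.1‖ + R * d ≤ w.2 ∧
      w.2 < ‖w.1‖ + 2 * (R * d) := by
  obtain ⟨h0, h1, h2, h3, h4⟩ := hw
  rw [abs_of_pos h0] at h1 h2 h3 h4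
  have := mul_pos hR hd
  have := norm_nonneg w.1
  refine ⟨?_, h0, ?_, ?_, ?_⟩ <;> linarith

theorem volume_closedBall_eq (n : ℕ) {r : ℝ} (hr : 0 ≤ r) :
    volume (Metric.closedBall (0 : EuclideanSpace ℝ (Fin n)) r) =
      ENNReal.ofReal ((volume (Metric.ball (0 : EuclideanSpace ℝ (Fin n)) 1)).toReal * r ^ n) := by
  rw [Measure.addHaar_closedBall _ _ hr, mul_comm, ENNReal.ofReal_mul ENNReal.toReal_nonneg,
    ENNReal.ofReal_toReal measure_ball_lt_top.ne]
  simp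

theorem volume_coneShell_le (n : ℕ) {R d : ℝ} (hR : 0 < R) (hd : 0 < d) :
    volume (coneShell n R d) ≤
      ENNReal.ofReal ((volume (Metric.ball (0 : EuclideanSpace ℝ (Fin n)) 1)).toReal *
        (d * R ^ (n + 1))) := by
  have h : coneShell n R d ⊆ {w : SpaceTime n | w.1 ∈ Metric.closedBall 0 R ∧
      ‖w.1‖ + R * d ≤ w.2 ∧ w.2 < ‖w.1‖ + 2 * (R * d)} := by
    intro w hw
    obtain ⟨h1, -, -, h2⟩ := norm_le_of_mem_coneShell hR hd hw
    exact ⟨by simpa using h1, h2⟩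
  refine (measure_mono h).trans ((volume_shear_le measurableSet_closedBall _).trans ?_)
  rw [volume_closedBall_eq n hR.le, ← ENNReal.ofReal_mul (by positivity)]
  refine ENNReal.ofReal_le_ofReal (le_of_eq ?_)
  ring

/-- Transversal translates of the shell have small overlap. -/
theorem volume_coneShell_overlap_le {n : ℕ} (hn : 2 ≤ n) {R d : ℝ} (hR : 0 < R) (hd : 0 < d)
    {v : SpaceTime n} (hv : R * d ^ (3 / 4 : ℝ) ≤ ‖v.1‖) :
    volume {w | w ∈ coneShell n R d ∧ w + v ∈ coneShell n R d} ≤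
      ENNReal.ofReal (2 ^ (n + 1) * d ^ (1 / 12 : ℝ) * (d * R ^ (n + 1))) := by
  obtain ⟨k, rfl⟩ : ∃ k, n = k + 2 := ⟨n - 2, by omega⟩
  have hd34 : 0 < d ^ (3 / 4 : ℝ) := Real.rpow_pos_of_pos hd _
  have hd12 : 0 < d ^ (1 / 12 : ℝ) := Real.rpow_pos_of_pos hd _
  have hv0 : v.1 ≠ 0 := norm_pos_iff.1 (lt_of_lt_of_le (by positivity) hv)
  set A : Set (EuclideanSpace ℝ (Fin (k + 2))) := {y | ‖y‖ ≤ R ∧ ‖y + v.1‖ ≤ R ∧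
    |‖y + v.1‖ - ‖y‖ - v.2| ≤ R * d} with hA
  have hAm : MeasurableSet A := by
    simp only [hA, Set.ofPred_and]
    refine (measurableSet_le ?_ ?_).inter ((measurableSet_le ?_ ?_).inter
      (measurableSet_le ?_ ?_)) <;> fun_prop
  have hsub : {w | w ∈ coneShell (k + 2) R d ∧ w + v ∈ coneShell (k + 2) R d} ⊆
      {w : SpaceTime (k + 2) | w.1 ∈ A ∧ ‖w.1‖ + R * d ≤ w.2 ∧ w.2 < ‖w.1‖ + 2 * (R * d)} := by
    rintro w ⟨h1, h2⟩
    obtain ⟨a1, -, -, a2, a3⟩ := norm_le_of_mem_coneShell hR hd h1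
    obtain ⟨b1, -, -, b2, b3⟩ := norm_le_of_mem_coneShell hR hd h2
    rw [Prod.fst_add] at b1 b2 b3
    rw [Prod.snd_add] at b2 b3
    refine ⟨⟨a1, b1, abs_le.2 ⟨?_, ?_⟩⟩, a2, a3⟩ <;> linarith
  refine (measure_mono hsub).trans ((volume_shear_le hAm _).trans ?_)
  -- The slab width `β = R d^(1/12)` balances the two terms when `‖v.1‖` is at the threshold: `d /
  -- (d^(3/4) d^(1/6)) = d^(1/12)`.
  have hvol := volume_norm_diff_le k (c := v.2) hR (by positivity : 0 ≤ R * d)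
    (by positivity : 0 < R * d ^ (1 / 12 : ℝ)) hv0
  refine (mul_le_mul_left hvol _).trans ?_
  rw [← ENNReal.ofReal_mul (by positivity)]
  refine ENNReal.ofReal_le_ofReal ?_
  have hexp : d = d ^ (3 / 4 : ℝ) * (d ^ (1 / 12 : ℝ)) ^ 3 := by
    rw [← Real.rpow_natCast, ← Real.rpow_mul hd.le, ← Real.rpow_add hd]
    norm_num
  have hfrac : 2 * (R * d) * R ^ 3 / (‖v.1‖ * (R * d ^ (1 / 12 : ℝ)) ^ 2) ≤
      2 * R * d ^ (1 / 12 : ℝ) := by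
    rw [div_le_iff₀ (by positivity)]
    calc 2 * (R * d) * R ^ 3 = 2 * R * d ^ (1 / 12 : ℝ) *
        ((R * d ^ (3 / 4 : ℝ)) * (R * d ^ (1 / 12 : ℝ)) ^ 2) := by
          conv_lhs => rw [hexp]
          ring
      _ ≤ _ := by gcongr
  calc (2 * R) ^ (k + 1) * (2 * (R * d ^ (1 / 12 : ℝ)) +
        2 * (R * d) * R ^ 3 / (‖v.1‖ * (R * d ^ (1 / 12 : ℝ)) ^ 2)) * (R * d)
      ≤ (2 * R) ^ (k + 1) * (2 * (R * d ^ (1 / 12 : ℝ)) + 2 * R * d ^ (1 / 12 : ℝ)) * (R * d) := by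
        gcongr
    _ = _ := by ring

/-! ### The gain from curvature on a single shell -/

/-- A cylinder in space-time. -/
def cylinder (n : ℕ) (r s : ℝ) : Set (SpaceTime n) :=
  Metric.closedBall 0 r ×ˢ Set.Icc (-s) s

theorem measurableSet_cylinder (n : ℕ) (r s : ℝ) : MeasurableSet (cylinder n r s) :=
  measurableSet_closedBall.prod measurableSet_Icc

theorem volume_cylinder (n : ℕ) {r s : ℝ} (hr : 0 ≤ r) :
    volume (cylinder n r s) =
      ENNReal.ofReal ((volume (Metric.ball (0 : EuclideanSpace ℝ (Fin n)) 1)).toReal * r ^ n *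
        (2 * s)) := by
  rw [cylinder, Measure.volume_eq_prod, Measure.prod_prod, volume_closedBall_eq n hr,
    Real.volume_Icc, ← ENNReal.ofReal_mul (by positivity)]
  congr 2
  ring

theorem lintegral_indicator_mul_lintegral_eq_setForm {n : ℕ} {S : Set (SpaceTime n)}
    (hS : MeasurableSet S) {f : SpaceTime n → ℝ≥0∞} (hf : Measurable f) (c : ℝ≥0∞) :
    ∫⁻ v, S.indicator (fun _ => c) v * ∫⁻ z, f z * f (z - v) = c * setForm volume S f f := by
  have hm : Measurable fun q : SpaceTime n × SpaceTime n => f q.2 * f (q.2 - q.1) :=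
    (hf.comp measurable_snd).mul (hf.comp (measurable_snd.sub measurable_fst))
  have h1 (v : SpaceTime n) : S.indicator (fun _ => c) v * ∫⁻ z, f z * f (z - v) =
      S.indicator (fun v => c * ∫⁻ z, f z * f (z - v)) v := by
    by_cases hv : v ∈ S <;> simp [hv]
  simp_rw [h1]
  rw [lintegral_indicator hS, lintegral_const_mul _ hm.lintegral_prod_right',
    lintegral_lintegral_swap hm.aemeasurable, setForm]
  congr 1
  refine lintegral_congr fun z => ?_
  exact lintegral_const_mul (f := fun w => f (z - w)) (f z)
    (hf.comp (measurable_const.sub measurable_id))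

/-- The mean-square bound for averages over the shell, with a gain in the eccentricity. -/
theorem exists_lintegral_sq_coneShell_le {n : ℕ} (hn : 2 ≤ n) :
    ∃ C : ℝ≥0, ∀ R d : ℝ, 0 < R → 0 < d → d ≤ 1 → ∀ f : SpaceTime n → ℝ≥0∞, Measurable f →
      ∫⁻ z, (∫⁻ w in coneShell n R d, f (z - w) ^ (47 / 48 : ℝ)) ^ 2 ≤
        C * ENNReal.ofReal (d ^ (1 / 48 : ℝ)) * ENNReal.ofReal (d * R ^ (n + 1)) ^ (25 / 24 : ℝ) *
          (∫⁻ z, f z) ^ (47 / 24 : ℝ) := by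
  set ω : ℝ := (volume (Metric.ball (0 : EuclideanSpace ℝ (Fin n)) 1)).toReal with hω
  have hω0 : 0 ≤ ω := ENNReal.toReal_nonneg
  refine ⟨Real.toNNReal (ω * (4 * ω) ^ (1 / 24 : ℝ) +
    2 ^ (n + 1) * (4 * ω * 2 ^ n) ^ (1 / 24 : ℝ)), ?_⟩
  intro R d hR hd hd1 f hf
  have hF : Measurable fun z => f z ^ (47 / 48 : ℝ) := hf.pow_const _
  set V : ℝ := d * R ^ (n + 1) with hV
  have hV0 : 0 < V := by positivity
  set I := ∫⁻ z, f z with hI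
  rw [lintegral_sq_setLIntegral_sub (measurableSet_coneShell n R d) hF]
  set S₁ := cylinder n (R * d ^ (3 / 4 : ℝ)) (2 * R)
  set S₂ := cylinder n (2 * R) (2 * R)
  have hd34 : 0 < d ^ (3 / 4 : ℝ) := Real.rpow_pos_of_pos hd _
  have hd12 : 0 < d ^ (1 / 12 : ℝ) := Real.rpow_pos_of_pos hd _
  set A : ℝ≥0∞ := ENNReal.ofReal (ω * V)
  set B : ℝ≥0∞ := ENNReal.ofReal (2 ^ (n + 1) * d ^ (1 / 12 : ℝ) * V)
  have hover (v : SpaceTime n) :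
      volume {w | w ∈ coneShell n R d ∧ w + v ∈ coneShell n R d} ≤
        S₁.indicator (fun _ => A) v + S₂.indicator (fun _ => B) v := by
    by_cases hne : {w | w ∈ coneShell n R d ∧ w + v ∈ coneShell n R d}.Nonempty
    · obtain ⟨w, hw1, hw2⟩ := hne
      obtain ⟨a1, a2, a3, -, -⟩ := norm_le_of_mem_coneShell hR hd hw1
      obtain ⟨b1, b2, b3, -, -⟩ := norm_le_of_mem_coneShell hR hd hw2
      rw [Prod.fst_add] at b1
      rw [Prod.snd_add] at b2 b3
      have hs : v.2 ∈ Set.Icc (-(2 * R)) (2 * R) := ⟨by linarith, by linarith⟩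
      have hy : ‖v.1‖ ≤ 2 * R := by
        have := norm_sub_le (w.1 + v.1) w.1
        rw [add_sub_cancel_left] at this
        linarith
      -- For short `v.1` the overlap may be the whole shell, but these `v` lie in the thin cylinder
      -- `S₁`; for the others transversality gives the gain `d^(1/12)`.
      rcases le_total ‖v.1‖ (R * d ^ (3 / 4 : ℝ)) with h | h
      · have hv : v ∈ S₁ := ⟨by simpa using h, hs⟩
        rw [Set.indicator_of_mem hv]
        refine le_add_right ?_
        exact (measure_mono fun w hw => hw.1).trans (volume_coneShell_le n hR hd)
      · have hv : v ∈ S₂ := ⟨by simpa using hy, hs⟩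
        rw [Set.indicator_of_mem hv]
        refine le_add_left ?_
        exact volume_coneShell_overlap_le hn hR hd h
    · rw [Set.not_nonempty_iff_eq_empty.1 hne]
      simp
  -- The exponent 47/48 is close enough to 1 that Young's inequality charges only the power 1/24 of
  -- the volume of the cylinder. On `S₂`, whose volume is of order `V / d`, the loss `d^(-1/24)` is
  -- thus smaller than the gain `d^(1/12)`.
  have hyoung (S : Set (SpaceTime n)) :
      setForm volume S (fun z => f z ^ (47 / 48 : ℝ)) (fun z => f z ^ (47 / 48 : ℝ)) ≤
        I ^ (47 / 24 : ℝ) * volume S ^ (1 / 24 : ℝ) := by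
    refine (setForm_rpow_le_young (μ := volume) (S := S) hf hf (x := 47 / 48) (y := 47 / 48)
      (by norm_num) (by norm_num) (by norm_num)).trans (le_of_eq ?_)
    rw [← ENNReal.rpow_add_of_nonneg _ _ (by norm_num) (by norm_num), hI]
    norm_num
  have hA : A * volume S₁ ^ (1 / 24 : ℝ) ≤
      ENNReal.ofReal (ω * (4 * ω) ^ (1 / 24 : ℝ) * (d ^ (1 / 48 : ℝ) * V ^ (25 / 24 : ℝ))) := by
    rw [volume_cylinder n (by positivity), ENNReal.ofReal_rpow_of_nonneg (by positivity)
      (by norm_num), ← ENNReal.ofReal_mul (by positivity)]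
    refine ENNReal.ofReal_le_ofReal ?_
    -- Since `n ≥ 2`, the volume of `S₁` is smaller than `V` by a factor of order `d^(1/2)`, whose
    -- power 1/24 is the final gain `d^(1/48)`.
    have hpow : (d ^ (3 / 4 : ℝ)) ^ n ≤ d ^ (3 / 2 : ℝ) := by
      rw [← Real.rpow_natCast, ← Real.rpow_mul hd.le]
      refine Real.rpow_le_rpow_of_exponent_ge hd hd1 ?_
      have : (2 : ℝ) ≤ n := by exact_mod_cast hn
      linarith
    have h1 : ω * (R * d ^ (3 / 4 : ℝ)) ^ n * (2 * (2 * R)) ≤ 4 * ω * (d ^ (1 / 2 : ℝ) * V) := by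
      have h32 : d ^ (3 / 2 : ℝ) = d ^ (1 / 2 : ℝ) * d := by
        rw [← Real.rpow_add_one hd.ne']
        norm_num
      calc ω * (R * d ^ (3 / 4 : ℝ)) ^ n * (2 * (2 * R))
          = 4 * ω * R ^ (n + 1) * (d ^ (3 / 4 : ℝ)) ^ n := by ring
        _ ≤ 4 * ω * R ^ (n + 1) * d ^ (3 / 2 : ℝ) := by gcongr
        _ = _ := by rw [h32, hV]; ring
    have h2 : (4 * ω * (d ^ (1 / 2 : ℝ) * V)) ^ (1 / 24 : ℝ) =
        (4 * ω) ^ (1 / 24 : ℝ) * (d ^ (1 / 48 : ℝ) * V ^ (1 / 24 : ℝ)) := by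
      rw [Real.mul_rpow (by positivity) (by positivity),
        Real.mul_rpow (x := d ^ (1 / 2 : ℝ)) (by positivity) (by positivity),
        ← Real.rpow_mul hd.le]
      norm_num
    have h3 : V ^ (25 / 24 : ℝ) = V * V ^ (1 / 24 : ℝ) := by
      rw [← Real.rpow_one_add' hV0.le (by norm_num)]
      norm_num
    calc ω * V * (ω * (R * d ^ (3 / 4 : ℝ)) ^ n * (2 * (2 * R))) ^ (1 / 24 : ℝ)
        ≤ ω * V * (4 * ω * (d ^ (1 / 2 : ℝ) * V)) ^ (1 / 24 : ℝ) := by gcongr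
      _ = _ := by rw [h2, h3]; ring
  have hB : B * volume S₂ ^ (1 / 24 : ℝ) ≤
      ENNReal.ofReal (2 ^ (n + 1) * (4 * ω * 2 ^ n) ^ (1 / 24 : ℝ) *
        (d ^ (1 / 48 : ℝ) * V ^ (25 / 24 : ℝ))) := by
    rw [volume_cylinder n (by positivity), ENNReal.ofReal_rpow_of_nonneg (by positivity)
      (by norm_num), ← ENNReal.ofReal_mul (by positivity)]
    refine ENNReal.ofReal_le_ofReal ?_
    have h1 : ω * (2 * R) ^ n * (2 * (2 * R)) = 4 * ω * 2 ^ n * R ^ (n + 1) := by ring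
    have h4 : V ^ (25 / 24 : ℝ) = V * (d ^ (1 / 24 : ℝ) * (R ^ (n + 1)) ^ (1 / 24 : ℝ)) := by
      rw [← Real.mul_rpow hd.le (by positivity), ← hV, ← Real.rpow_one_add' hV0.le (by norm_num)]
      norm_num
    have h5 : d ^ (1 / 12 : ℝ) ≤ d ^ (1 / 48 : ℝ) * d ^ (1 / 24 : ℝ) := by
      rw [← Real.rpow_add hd]
      exact Real.rpow_le_rpow_of_exponent_ge hd hd1 (by norm_num)
    rw [h1, Real.mul_rpow (by positivity) (by positivity), h4]
    calc 2 ^ (n + 1) * d ^ (1 / 12 : ℝ) * V *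
          ((4 * ω * 2 ^ n) ^ (1 / 24 : ℝ) * (R ^ (n + 1)) ^ (1 / 24 : ℝ))
        ≤ 2 ^ (n + 1) * (d ^ (1 / 48 : ℝ) * d ^ (1 / 24 : ℝ)) * V *
          ((4 * ω * 2 ^ n) ^ (1 / 24 : ℝ) * (R ^ (n + 1)) ^ (1 / 24 : ℝ)) := by gcongr
      _ = _ := by ring
  have hm : Measurable fun v => ∫⁻ z, f z ^ (47 / 48 : ℝ) * f (z - v) ^ (47 / 48 : ℝ) := by
    refine Measurable.lintegral_prod_right' (f := fun q : SpaceTime n × SpaceTime n =>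
      f q.2 ^ (47 / 48 : ℝ) * f (q.2 - q.1) ^ (47 / 48 : ℝ)) ?_
    exact (hF.comp measurable_snd).mul (hF.comp (measurable_snd.sub measurable_fst))
  calc _ ≤ ∫⁻ v, (S₁.indicator (fun _ => A) v + S₂.indicator (fun _ => B) v) *
        ∫⁻ z, f z ^ (47 / 48 : ℝ) * f (z - v) ^ (47 / 48 : ℝ) :=
        lintegral_mono fun v => mul_le_mul_left (hover v) _
    _ = A * setForm volume S₁ (fun z => f z ^ (47 / 48 : ℝ)) (fun z => f z ^ (47 / 48 : ℝ)) +
        B * setForm volume S₂ (fun z => f z ^ (47 / 48 : ℝ)) (fun z => f z ^ (47 / 48 : ℝ)) := by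
        simp_rw [add_mul]
        rw [lintegral_add_left (f := fun v => S₁.indicator (fun _ => A) v *
            ∫⁻ z, f z ^ (47 / 48 : ℝ) * f (z - v) ^ (47 / 48 : ℝ))
            ((measurable_const.indicator (measurableSet_cylinder _ _ _)).mul hm),
          lintegral_indicator_mul_lintegral_eq_setForm (measurableSet_cylinder _ _ _) hF,
          lintegral_indicator_mul_lintegral_eq_setForm (measurableSet_cylinder _ _ _) hF]
    _ ≤ A * (I ^ (47 / 24 : ℝ) * volume S₁ ^ (1 / 24 : ℝ)) +
        B * (I ^ (47 / 24 : ℝ) * volume S₂ ^ (1 / 24 : ℝ)) := by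
        gcongr <;> exact hyoung _
    _ = (A * volume S₁ ^ (1 / 24 : ℝ) + B * volume S₂ ^ (1 / 24 : ℝ)) * I ^ (47 / 24 : ℝ) := by
        ring
    _ ≤ _ := by
        gcongr
        refine (add_le_add hA hB).trans (le_of_eq ?_)
        rw [← ENNReal.ofReal_add (by positivity) (by positivity), ← add_mul,
          ENNReal.ofReal_mul (by positivity), ENNReal.ofReal_mul (by positivity),
          ENNReal.ofReal_rpow_of_nonneg hV0.le (by norm_num), ← mul_assoc]
        rfl

/-- The bound for a single shell, with a gain in the eccentricity. -/
theorem exists_setForm_coneShell_le {x y : ℝ} (hx : x < 1) (hy : y < 1)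
    (hxy : 1 < x + y) :
    ∃ τ : ℝ, 0 < τ ∧ ∀ n : ℕ, 2 ≤ n → ∃ C : ℝ≥0, ∀ R d : ℝ, 0 < R → 0 < d → d ≤ 1 →
      ∀ f g : SpaceTime n → ℝ≥0∞, Measurable f → Measurable g →
        setForm volume (coneShell n R d) (fun z => f z ^ x) (fun z => g z ^ y) ≤
          C * ENNReal.ofReal d ^ τ * ENNReal.ofReal (d * R ^ (n + 1)) ^ (2 - x - y) *
            (∫⁻ z, f z) ^ x * (∫⁻ z, g z) ^ y := by
  -- `t` is the weight of the improved bound; these conditions keep the weights `a`, `b`, `c` of the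
  -- trivial bounds nonnegative. The gain `d^(1/48)` is halved by Cauchy–Schwarz and then raised to
  -- the power `t`, whence `t / 96`.
  obtain ⟨t, ht0, ht1, ht2, ht3⟩ : ∃ t : ℝ, 0 < t ∧ t ≤ x + y - 1 ∧ t ≤ 1 - x ∧ t ≤ 1 - y :=
    ⟨min (x + y - 1) (min (1 - x) (1 - y)), by
      refine lt_min ?_ (lt_min ?_ ?_) <;> linarith, min_le_left _ _,
      (min_le_right _ _).trans (min_le_left _ _), (min_le_right _ _).trans (min_le_right _ _)⟩
  refine ⟨t / 96, by positivity, fun n hn => ?_⟩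
  obtain ⟨C, hC⟩ := exists_lintegral_sq_coneShell_le hn
  obtain ⟨a, ha⟩ : ∃ a, a = x + y - 1 - 23 / 48 * t := ⟨_, rfl⟩
  obtain ⟨b, hb⟩ : ∃ b, b = 1 - y - t / 2 := ⟨_, rfl⟩
  obtain ⟨c, hc⟩ : ∃ c, c = 1 - x - t / 48 := ⟨_, rfl⟩
  have ha0 : 0 ≤ a := by linarith
  have hb0 : 0 ≤ b := by linarith
  have hc0 : 0 ≤ c := by linarith
  set ω : ℝ≥0 := Real.toNNReal (volume (Metric.ball (0 : EuclideanSpace ℝ (Fin n)) 1)).toReal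
  refine ⟨ω ^ b * ω ^ c * C ^ (t / 2), ?_⟩
  intro R d hR hd hd1 f g hf hg
  set T := coneShell n R d
  set V := ENNReal.ofReal (d * R ^ (n + 1)) with hV
  set F := ∫⁻ z, f z
  set G := ∫⁻ z, g z
  set D := ENNReal.ofReal d with hD
  have hT : volume T ≤ ω * V := by
    refine (volume_coneShell_le n hR hd).trans (le_of_eq ?_)
    rw [ENNReal.ofReal_mul ENNReal.toReal_nonneg]
    rfl
  have hgain : setForm volume T (fun z => f z ^ (47 / 48 : ℝ)) (fun z => g z ^ (1 / 2 : ℝ)) ≤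
      G ^ (1 / 2 : ℝ) * (C * D ^ (1 / 48 : ℝ) * V ^ (25 / 24 : ℝ) * F ^ (47 / 24 : ℝ)) ^
        (1 / 2 : ℝ) := by
    have hm : Measurable fun z => ∫⁻ w in T, f (z - w) ^ (47 / 48 : ℝ) :=
      Measurable.lintegral_prod_right' (f := fun q : SpaceTime n × SpaceTime n =>
        f (q.1 - q.2) ^ (47 / 48 : ℝ)) ((measurable_comp_sub hf).pow_const _)
    have h := ENNReal.lintegral_mul_le_Lp_mul_Lq volume (p := 2) (q := 2)
      Real.HolderConjugate.two_two (hg.pow_const (1 / 2 : ℝ)).aemeasurable hm.aemeasurable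
    refine h.trans ?_
    have e1 : ∫⁻ z, (g z ^ (1 / 2 : ℝ)) ^ (2 : ℝ) = G := by
      refine lintegral_congr fun z => ?_
      rw [← ENNReal.rpow_mul]
      norm_num
    rw [e1]
    gcongr
    have h2 := hC R d hR hd hd1 f hf
    rw [← ENNReal.ofReal_rpow_of_pos hd] at h2
    exact_mod_cast h2
  have key := setForm_rpow_le_interpolation (μ := volume) (S := T) hf hg ha0 hb0 hc0 ht0.le
    (u := 47 / 48) (v := 1 / 2) (by norm_num) (by norm_num) (by linarith)
  have ex : a + b + 47 / 48 * t = x := by linarith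
  have ey : a + c + 1 / 2 * t = y := by linarith
  rw [ex, ey] at key
  refine key.trans ?_
  have eF : F ^ x = F ^ a * F ^ b * F ^ (47 / 48 * t) := by
    rw [← ENNReal.rpow_add_of_nonneg _ _ ha0 hb0,
      ← ENNReal.rpow_add_of_nonneg _ _ (by positivity) (by positivity), ex]
  have eG : G ^ y = G ^ a * G ^ c * G ^ (1 / 2 * t) := by
    rw [← ENNReal.rpow_add_of_nonneg _ _ ha0 hc0,
      ← ENNReal.rpow_add_of_nonneg _ _ (by positivity) (by positivity), ey]
  have eV : V ^ (2 - x - y) = V ^ b * V ^ c * V ^ (25 / 48 * t) := by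
    rw [← ENNReal.rpow_add_of_nonneg _ _ hb0 hc0,
      ← ENNReal.rpow_add_of_nonneg _ _ (by positivity) (by positivity)]
    congr 1
    linarith
  calc (F * G) ^ a * (F * volume T) ^ b * (G * volume T) ^ c *
        (setForm volume T (fun z => f z ^ (47 / 48 : ℝ)) (fun z => g z ^ (1 / 2 : ℝ))) ^ t
      ≤ (F * G) ^ a * (F * (ω * V)) ^ b * (G * (ω * V)) ^ c *
        (G ^ (1 / 2 : ℝ) * (C * D ^ (1 / 48 : ℝ) * V ^ (25 / 24 : ℝ) * F ^ (47 / 24 : ℝ)) ^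
        (1 / 2 : ℝ)) ^ t := by gcongr
    _ = _ := by
      rw [eF, eG, eV, ENNReal.mul_rpow_of_nonneg _ _ ha0, ENNReal.mul_rpow_of_nonneg _ _ hb0,
        ENNReal.mul_rpow_of_nonneg _ _ hb0, ENNReal.mul_rpow_of_nonneg _ _ hc0,
        ENNReal.mul_rpow_of_nonneg _ _ hc0, ENNReal.mul_rpow_of_nonneg _ _ ht0.le,
        ← ENNReal.rpow_mul, ← ENNReal.rpow_mul]
      have h2 : (0 : ℝ) ≤ 1 / 2 * t := by positivity
      rw [ENNReal.mul_rpow_of_nonneg _ _ h2, ENNReal.mul_rpow_of_nonneg _ _ h2,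
        ENNReal.mul_rpow_of_nonneg _ _ h2, ← ENNReal.rpow_mul, ← ENNReal.rpow_mul,
        ← ENNReal.rpow_mul]
      have e1 : (1 / 48 : ℝ) * (1 / 2 * t) = t / 96 := by ring
      have e2 : (25 / 24 : ℝ) * (1 / 2 * t) = 25 / 48 * t := by ring
      have e3 : (47 / 24 : ℝ) * (1 / 2 * t) = 47 / 48 * t := by ring
      have e4 : (1 / 2 : ℝ) * t = t / 2 := by ring
      rw [e1, e2, e3, e4]
      push_cast
      rw [ENNReal.coe_rpow_of_nonneg _ hb0, ENNReal.coe_rpow_of_nonneg _ hc0,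
        ENNReal.coe_rpow_of_nonneg _ (by positivity : 0 ≤ t / 2)]
      ring

/-! ### Summation over the scales -/

theorem two_rpow_add (a b : ℝ) : (2 : ℝ≥0∞) ^ (a + b) = 2 ^ a * 2 ^ b :=
  ENNReal.rpow_add _ _ two_ne_zero ENNReal.ofNat_ne_top

theorem tsum_two_rpow_abs_lt_top {e : ℝ} (he : 0 < e) :
    ∑' j : ℤ, (2 : ℝ≥0∞) ^ (-e * |(j : ℝ)|) < ∞ := by
  obtain ⟨ρ, hρ⟩ : ∃ ρ : ℝ≥0, ρ = 2 ^ (-e) := ⟨_, rfl⟩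
  have hρ1 : ρ < 1 := hρ ▸ NNReal.rpow_lt_one_of_one_lt_of_neg one_lt_two (by linarith)
  have h1 (j : ℤ) : (2 : ℝ≥0∞) ^ (-e * |(j : ℝ)|) = ((ρ ^ j.natAbs : ℝ≥0) : ℝ≥0∞) := by
    have hj : |(j : ℝ)| = ((j.natAbs : ℕ) : ℝ) := by rw [Nat.cast_natAbs, Int.cast_abs]
    rw [ENNReal.rpow_mul, hj, ENNReal.rpow_natCast, ENNReal.coe_pow, hρ,
      ENNReal.coe_rpow_of_ne_zero two_ne_zero]
    rfl
  have h2 : Summable fun j : ℤ => ρ ^ j.natAbs := by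
    rw [← NNReal.summable_coe]
    refine Summable.of_nat_of_neg ?_ ?_ <;>
      simpa using summable_geometric_of_lt_one ρ.coe_nonneg hρ1
  rw [lt_top_iff_ne_top, tsum_congr h1]
  exact ENNReal.tsum_coe_ne_top_iff_summable.2 h2

/-- The points `N j + r` are spaced by at least 1, so the sum is geometric uniformly in `N` and `r`.
This uniformity in `r` is what makes the later constants independent of `ℓ`. -/
theorem exists_tsum_two_rpow_abs_le {e : ℝ} (he : 0 < e) :
    ∃ K : ℝ≥0, ∀ N : ℕ, 1 ≤ N → ∀ r : ℝ,
      ∑' j : ℤ, (2 : ℝ≥0∞) ^ (-e * |(N : ℝ) * j + r|) ≤ K := by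
  refine ⟨((2 : ℝ≥0∞) ^ e * ∑' j : ℤ, (2 : ℝ≥0∞) ^ (-e * |(j : ℝ)|)).toNNReal, fun N hN r => ?_⟩
  rw [ENNReal.coe_toNNReal (ENNReal.mul_lt_top
    (ENNReal.rpow_lt_top_of_nonneg he.le ENNReal.ofNat_ne_top)
    -- Re-indexing moves the offset into `(-N, 0]`; the factor `2 ^ e` pays for the remaining loss
    -- of 1 in `|j|`.
    (tsum_two_rpow_abs_lt_top he)).ne, ← (Equiv.addRight ⌊-r / N⌋).tsum_eq, ← ENNReal.tsum_mul_left]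
  refine ENNReal.tsum_le_tsum fun j => ?_
  rw [← two_rpow_add]
  refine ENNReal.rpow_le_rpow_of_exponent_le (by norm_num) ?_
  have hN' : (1 : ℝ) ≤ N := by exact_mod_cast hN
  have h1 := Int.floor_le (-r / N)
  have h2 := Int.lt_floor_add_one (-r / N)
  rw [le_div_iff₀ (by linarith)] at h1
  rw [div_lt_iff₀ (by linarith)] at h2
  set m : ℝ := (⌊-r / N⌋ : ℝ)
  have h3 : |(j : ℝ)| - 1 ≤ |(N : ℝ) * ((Equiv.addRight ⌊-r / N⌋) j : ℤ) + r| := by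
    have e1 : (((Equiv.addRight ⌊-r / N⌋) j : ℤ) : ℝ) = j + m := by
      simp [m]
    rw [e1]
    rcases le_or_gt 1 |(j : ℝ)| with hj | hj
    · have h4 : (N : ℝ) * |(j : ℝ)| ≤ |(N : ℝ) * (j + m) + r| + N := by
        have e2 : (N : ℝ) * |(j : ℝ)| = |((N : ℝ) * (j + m) + r) + (-(N * m + r))| := by
          rw [show (N : ℝ) * (j + m) + r + -(N * m + r) = N * j by ring, abs_mul,
            abs_of_nonneg (by linarith : (0 : ℝ) ≤ N)]
        rw [e2]
        refine (abs_add_le _ _).trans (add_le_add_right ?_ _)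
        rw [abs_le]
        constructor <;> nlinarith
      nlinarith
    · have := abs_nonneg ((N : ℝ) * (j + m) + r)
      linarith
  nlinarith

/-- At scale `2 ^ v`, the points where `φ` is large (for `s < 1`) or small (for `s ≥ 1`). -/
def levelSet {G : Type*} (s v : ℝ) (φ : G → ℝ≥0∞) : Set G :=
  {z | if s < 1 then (2 : ℝ≥0∞) ^ (-v) < φ z else φ z ≤ 2 ^ (-v)}

/-- Writing `φ z = 2 ^ μ`, the term at `v = N j + r` is `φ z` times `2 ^ ((s - 1)(v + μ))`. The
level set retains only scales at which this exponent is nonpositive, so the sum is geometric about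
`v = -μ`. -/
theorem exists_tsum_levelSet_le {s : ℝ} (hs0 : 0 < s) (hs : s ≠ 1) :
    ∃ K : ℝ≥0, ∀ {G : Type} (φ : G → ℝ≥0∞) (z : G) (N : ℕ), 1 ≤ N → ∀ r : ℝ,
      ∑' j : ℤ, (2 : ℝ≥0∞) ^ ((s - 1) * ((N : ℝ) * j + r)) *
        ((levelSet s ((N : ℝ) * j + r) φ).indicator φ z) ^ s ≤ K * φ z := by
  obtain ⟨K, hK⟩ := exists_tsum_two_rpow_abs_le (e := |s - 1|) (abs_pos.2 (sub_ne_zero.2 hs))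
  -- The added 1 makes the constant nonzero, so that the right-hand side is infinite when `φ z = ∞`.
  refine ⟨K + 1, fun {G} φ z N hN r => ?_⟩
  have hle (j : ℤ) : (levelSet s ((N : ℝ) * j + r) φ).indicator φ z ≤ φ z :=
    Set.indicator_le_self' (fun _ _ => zero_le) z
  rcases eq_or_ne (φ z) 0 with h0 | h0
  · have : ∀ j : ℤ, (levelSet s ((N : ℝ) * j + r) φ).indicator φ z = 0 := fun j =>
      le_antisymm ((hle j).trans h0.le) zero_le
    simp [this, ENNReal.zero_rpow_of_pos hs0]
  rcases eq_or_ne (φ z) ∞ with ht | ht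
  · rw [ht, ENNReal.mul_top (by simp)]
    exact le_top
  obtain ⟨μ, hμ⟩ : ∃ μ : ℝ, φ z = 2 ^ μ := by
    refine ⟨Real.logb 2 (φ z).toReal, ?_⟩
    have hpos := ENNReal.toReal_pos h0 ht
    rw [← ENNReal.ofReal_ofNat 2, ENNReal.ofReal_rpow_of_pos two_pos,
      Real.rpow_logb two_pos (by norm_num) hpos, ENNReal.ofReal_toReal ht]
  have hterm (j : ℤ) : (2 : ℝ≥0∞) ^ ((s - 1) * ((N : ℝ) * j + r)) *
        ((levelSet s ((N : ℝ) * j + r) φ).indicator φ z) ^ s ≤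
        φ z * 2 ^ (-|s - 1| * |(N : ℝ) * j + (r + μ)|) := by
    set v : ℝ := (N : ℝ) * j + r with hv
    by_cases hz : z ∈ levelSet s v φ
    · rw [Set.indicator_of_mem hz, hμ, ← ENNReal.rpow_mul, ← two_rpow_add, ← two_rpow_add]
      refine ENNReal.rpow_le_rpow_of_exponent_le (by norm_num) ?_
      rw [← add_assoc, ← hv, neg_mul, ← abs_mul]
      have hsign : (s - 1) * (v + μ) ≤ 0 := by
        simp only [levelSet, Set.mem_ofPred_eq, hμ] at hz
        split_ifs at hz with hs1
        · have : -v < μ := by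
            by_contra! hcon
            exact absurd hz (not_lt.2 (ENNReal.rpow_le_rpow_of_exponent_le (by norm_num) hcon))
          nlinarith
        · have : μ ≤ -v := by
            by_contra! hcon
            exact absurd hz (not_le.2 (ENNReal.rpow_lt_rpow_of_exponent_lt (by norm_num)
              ENNReal.ofNat_ne_top hcon))
          nlinarith [not_lt.1 hs1]
      rw [abs_of_nonpos hsign]
      linarith
    · rw [Set.indicator_of_notMem hz, ENNReal.zero_rpow_of_pos hs0, mul_zero]
      exact zero_le
  calc _ ≤ ∑' j : ℤ, φ z * 2 ^ (-|s - 1| * |(N : ℝ) * j + (r + μ)|) := ENNReal.tsum_le_tsum hterm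
    _ = φ z * ∑' j : ℤ, 2 ^ (-|s - 1| * |(N : ℝ) * j + (r + μ)|) := ENNReal.tsum_mul_left
    _ ≤ φ z * K := by gcongr; exact hK N hN _
    _ ≤ _ := by rw [mul_comm]; gcongr; exact le_self_add

theorem measurableSet_levelSet {G : Type*} [MeasurableSpace G] {φ : G → ℝ≥0∞} (hφ : Measurable φ)
    (s v : ℝ) : MeasurableSet (levelSet s v φ) := by
  by_cases h : s < 1
  · simp only [levelSet, h, if_true]
    exact measurableSet_lt measurable_const hφ
  · simp only [levelSet, h, if_false]
    exact measurableSet_le hφ measurable_const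

theorem exists_tsum_lintegral_levelSet_le {s : ℝ} (hs0 : 0 < s) (hs : s ≠ 1) :
    ∃ K : ℝ≥0, ∀ {G : Type} [MeasurableSpace G] (μ : Measure G) (φ : G → ℝ≥0∞), Measurable φ →
      ∀ N : ℕ, 1 ≤ N → ∀ r : ℝ,
      ∑' j : ℤ, (2 : ℝ≥0∞) ^ ((s - 1) * ((N : ℝ) * j + r)) *
        ∫⁻ z, ((levelSet s ((N : ℝ) * j + r) φ).indicator φ z) ^ s ∂μ ≤ K * ∫⁻ z, φ z ∂μ := by
  obtain ⟨K, hK⟩ := exists_tsum_levelSet_le hs0 hs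
  refine ⟨K, fun {G} _ μ φ hφ N hN r => ?_⟩
  have hm (j : ℤ) : Measurable fun z => ((levelSet s ((N : ℝ) * j + r) φ).indicator φ z) ^ s :=
    (hφ.indicator (measurableSet_levelSet hφ _ _)).pow_const _
  rw [tsum_congr fun j => (lintegral_const_mul _ (hm j)).symm]
  rw [← lintegral_tsum fun j => ((hm j).const_mul _).aemeasurable, ← lintegral_const_mul _ hφ]
  exact lintegral_mono fun z => hK φ z N hN r

/-- This replaces Hölder's inequality for sums when the exponents add up to at least 1: the surplus
homogeneity is absorbed by the uniform bound `K`. -/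
theorem rpow_mul_rpow_le_mul_add {K c d : ℝ≥0∞} {x y : ℝ} (hx : 0 ≤ x) (hy : 0 ≤ y)
    (hxy : 1 ≤ x + y) (hc : c ≤ K) (hd : d ≤ K) :
    c ^ x * d ^ y ≤ K ^ (x + y - 1) * (c + d) := by
  have hm : max c d ≤ K := max_le hc hd
  calc c ^ x * d ^ y ≤ max c d ^ x * max c d ^ y := by
        gcongr
        · exact le_max_left _ _
        · exact le_max_right _ _
    _ = max c d ^ (x + y - 1) * max c d := by
        rw [← ENNReal.rpow_add_of_nonneg _ _ hx hy]
        nth_rw 3 [← ENNReal.rpow_one (max c d)]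
        rw [← ENNReal.rpow_add_of_nonneg _ _ (by linarith) zero_le_one, sub_add_cancel]
    _ ≤ _ := by
        have : 0 ≤ x + y - 1 := by linarith
        have h2 : max c d ≤ c + d := max_le le_self_add le_add_self
        gcongr

theorem measurable_setLIntegral_sub {G : Type*} [AddCommGroup G] [MeasurableSpace G]
    [MeasurableAdd₂ G] [MeasurableNeg G] {μ : Measure G} [SFinite μ] {f : G → ℝ≥0∞}
    (hf : Measurable f) (S : Set G) : Measurable fun z => ∫⁻ w in S, f (z - w) ∂μ :=
  Measurable.lintegral_prod_right' (f := fun q : G × G => f (q.1 - q.2)) (measurable_comp_sub hf)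

theorem setForm_add_left {G : Type*} [AddCommGroup G] [MeasurableSpace G] [MeasurableAdd₂ G]
    [MeasurableNeg G] {μ : Measure G} [SFinite μ] {S : Set G} {f₁ f₂ g : G → ℝ≥0∞}
    (hf₁ : Measurable f₁) (hg : Measurable g) :
    setForm μ S (fun z => f₁ z + f₂ z) g = setForm μ S f₁ g + setForm μ S f₂ g := by
  have h (z : G) : Measurable fun w => f₁ (z - w) :=
    (measurable_comp_sub hf₁).comp (measurable_const.prodMk measurable_id)
  simp only [setForm]
  have h2 : Measurable fun z => g z * ∫⁻ w in S, f₁ (z - w) ∂μ :=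
    hg.mul (measurable_setLIntegral_sub hf₁ S)
  rw [← lintegral_add_left h2]
  refine lintegral_congr fun z => ?_
  rw [lintegral_add_left (h z), mul_add]

theorem setForm_add_right {G : Type*} [AddCommGroup G] [MeasurableSpace G] [MeasurableAdd₂ G]
    [MeasurableNeg G] {μ : Measure G} [SFinite μ] {S : Set G} {f g₁ g₂ : G → ℝ≥0∞}
    (hf : Measurable f) (hg₁ : Measurable g₁) :
    setForm μ S f (fun z => g₁ z + g₂ z) = setForm μ S f g₁ + setForm μ S f g₂ := by
  simp only [setForm]
  have h2 : Measurable fun z => g₁ z * ∫⁻ w in S, f (z - w) ∂μ :=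
    hg₁.mul (measurable_setLIntegral_sub hf S)
  rw [← lintegral_add_left h2]
  exact lintegral_congr fun z => add_mul _ _ _

theorem setForm_const_mul {G : Type*} [AddCommGroup G] [MeasurableSpace G] [MeasurableAdd₂ G]
    [MeasurableNeg G] {μ : Measure G} [SFinite μ] {S : Set G} {f g : G → ℝ≥0∞}
    (hf : Measurable f) (hg : Measurable g) (a b : ℝ≥0∞) :
    setForm μ S (fun z => a * f z) (fun z => b * g z) = a * b * setForm μ S f g := by
  have h (z : G) : Measurable fun w => f (z - w) :=
    (measurable_comp_sub hf).comp (measurable_const.prodMk measurable_id)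
  simp only [setForm]
  have h2 : Measurable fun z => g z * ∫⁻ w in S, f (z - w) ∂μ :=
    hg.mul (measurable_setLIntegral_sub hf S)
  rw [← lintegral_const_mul _ h2]
  refine lintegral_congr fun z => ?_
  rw [lintegral_const_mul _ (h z)]
  ring

theorem ofReal_coneShell_scale (n l : ℕ) (j : ℤ) :
    ENNReal.ofReal ((2 : ℝ) ^ (-(l : ℝ)) * ((2 : ℝ) ^ j) ^ (n + 1)) =
      2 ^ (((n + 1 : ℕ) : ℝ) * j + -(l : ℝ)) := by
  rw [← Real.rpow_intCast, ← Real.rpow_natCast, ← Real.rpow_mul two_pos.le, ← Real.rpow_add two_pos,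
    ← ENNReal.ofReal_rpow_of_pos two_pos, ENNReal.ofReal_ofNat]
  congr 1
  ring

/-- Summation over the scales of the contributions of given level sets. -/
theorem exists_tsum_setForm_levelSet_le {x y s t : ℝ} (hx : 0 < x) (hy : 0 < y)
    (hs0 : 0 < s) (hs : s ≠ 1) (ht0 : 0 < t) (ht : t ≠ 1) (hxs : x / s < 1) (hyt : y / t < 1)
    (hst : 1 < x / s + y / t) :
    ∃ τ : ℝ, 0 < τ ∧ ∀ n : ℕ, 2 ≤ n → ∃ C : ℝ≥0, ∀ l : ℕ,
      ∀ φ ψ : SpaceTime n → ℝ≥0∞, Measurable φ → Measurable ψ → ∫⁻ z, φ z ≤ 1 → ∫⁻ z, ψ z ≤ 1 →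
        ∑' j : ℤ, (2 : ℝ≥0∞) ^ (-(2 - x - y) * (((n + 1 : ℕ) : ℝ) * j + -(l : ℝ))) *
          setForm volume (truncatedCone n l j)
            (fun z => (levelSet s (((n + 1 : ℕ) : ℝ) * j + -(l : ℝ)) φ).indicator φ z ^ x)
            (fun z => (levelSet t (((n + 1 : ℕ) : ℝ) * j + -(l : ℝ)) ψ).indicator ψ z ^ y) ≤
        C * ENNReal.ofReal (2 ^ (-(l : ℝ))) ^ τ := by
  obtain ⟨τ, hτ, hC⟩ := exists_setForm_coneShell_le hxs hyt hst
  refine ⟨τ, hτ, fun n hn => ?_⟩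
  obtain ⟨C, hC⟩ := hC n hn
  obtain ⟨K₁, hK₁⟩ := exists_tsum_lintegral_levelSet_le hs0 hs
  obtain ⟨K₂, hK₂⟩ := exists_tsum_lintegral_levelSet_le ht0 ht
  set K := max K₁ K₂
  have hxs0 : 0 < x / s := by positivity
  have hyt0 : 0 < y / t := by positivity
  refine ⟨C * K ^ (x / s + y / t - 1) * (K₁ + K₂), fun l φ ψ hφ hψ hφ1 hψ1 => ?_⟩
  set D := ENNReal.ofReal (2 ^ (-(l : ℝ)))
  let v : ℤ → ℝ := fun j => ((n + 1 : ℕ) : ℝ) * j + -(l : ℝ)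
  let φ' : ℤ → SpaceTime n → ℝ≥0∞ := fun j => (levelSet s (v j) φ).indicator φ
  let ψ' : ℤ → SpaceTime n → ℝ≥0∞ := fun j => (levelSet t (v j) ψ).indicator ψ
  have hφ' (j : ℤ) : Measurable (φ' j) := hφ.indicator (measurableSet_levelSet hφ _ _)
  have hψ' (j : ℤ) : Measurable (ψ' j) := hψ.indicator (measurableSet_levelSet hψ _ _)
  let c : ℤ → ℝ≥0∞ := fun j => 2 ^ ((s - 1) * v j) * ∫⁻ z, φ' j z ^ s
  let d : ℤ → ℝ≥0∞ := fun j => 2 ^ ((t - 1) * v j) * ∫⁻ z, ψ' j z ^ t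
  have hc : ∑' j, c j ≤ K₁ := by
    refine (hK₁ volume φ hφ (n + 1) (by omega) (-(l : ℝ))).trans ?_
    exact (mul_le_mul_right hφ1 _).trans (mul_one _).le
  have hd : ∑' j, d j ≤ K₂ := by
    refine (hK₂ volume ψ hψ (n + 1) (by omega) (-(l : ℝ))).trans ?_
    exact (mul_le_mul_right hψ1 _).trans (mul_one _).le
  have hcK (j : ℤ) : c j ≤ K := (ENNReal.le_tsum j).trans (hc.trans (by simp [K]))
  have hdK (j : ℤ) : d j ≤ K := (ENNReal.le_tsum j).trans (hd.trans (by simp [K]))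
  have hterm (j : ℤ) : (2 : ℝ≥0∞) ^ (-(2 - x - y) * v j) *
      setForm volume (truncatedCone n l j) (fun z => φ' j z ^ x) (fun z => ψ' j z ^ y) ≤
      C * D ^ τ * (K ^ (x / s + y / t - 1) * (c j + d j)) := by
    refine le_trans ?_ (mul_le_mul_right (rpow_mul_rpow_le_mul_add hxs0.le hyt0.le hst.le
      (hcK j) (hdK j)) _)
    -- The shell estimate at the exponents `x / s`, `y / t` is applied to the powers `φ' ^ s`, `ψ' ^
    -- t`, which restores `φ' ^ x` and `ψ' ^ y` in the form.
    have h := hC ((2 : ℝ) ^ j) (2 ^ (-(l : ℝ))) (by positivity) (by positivity)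
      (Real.rpow_le_one_of_one_le_of_nonpos one_le_two (by simp)) (fun z => φ' j z ^ s)
      (fun z => ψ' j z ^ t) ((hφ' j).pow_const _) ((hψ' j).pow_const _)
    simp only [← ENNReal.rpow_mul, mul_div_cancel₀ _ hs0.ne', mul_div_cancel₀ _ ht0.ne'] at h
    rw [← truncatedCone_eq_coneShell, ofReal_coneShell_scale, ← ENNReal.rpow_mul] at h
    refine (mul_le_mul_right h _).trans (le_of_eq ?_)
    simp only [c, d]
    rw [ENNReal.mul_rpow_of_nonneg _ _ hxs0.le, ENNReal.mul_rpow_of_nonneg _ _ hyt0.le,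
      ← ENNReal.rpow_mul, ← ENNReal.rpow_mul]
    -- The mismatch of the volume powers caused by the perturbed exponents is precisely the weight
    -- built into `c` and `d`.
    have e : (2 : ℝ≥0∞) ^ (-(2 - x - y) * v j) * 2 ^ (v j * (2 - x / s - y / t)) =
        2 ^ ((s - 1) * v j * (x / s)) * 2 ^ ((t - 1) * v j * (y / t)) := by
      rw [← two_rpow_add, ← two_rpow_add]
      congr 1
      field_simp
      ring
    calc _ = ((2 : ℝ≥0∞) ^ (-(2 - x - y) * v j) * 2 ^ (v j * (2 - x / s - y / t))) *
          (C * D ^ τ * (∫⁻ z, φ' j z ^ s) ^ (x / s) * (∫⁻ z, ψ' j z ^ t) ^ (y / t)) := by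
          ring
      _ = _ := by rw [e]; ring
  calc _ ≤ ∑' j, C * D ^ τ * (K ^ (x / s + y / t - 1) * (c j + d j)) := ENNReal.tsum_le_tsum hterm
    _ = C * D ^ τ * (K ^ (x / s + y / t - 1) * (∑' j, c j + ∑' j, d j)) := by
        rw [ENNReal.tsum_mul_left, ENNReal.tsum_mul_left, ENNReal.tsum_add]
    _ ≤ C * D ^ τ * (K ^ (x / s + y / t - 1) * (K₁ + K₂)) := by gcongr
    _ = _ := by
        push_cast
        rw [ENNReal.coe_rpow_of_nonneg _ (by linarith : 0 ≤ x / s + y / t - 1)]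
        ring

/-- A level set depends on its parameter only through the side of 1 on which it lies, so one from
each side gives complementary sets. -/
theorem rpow_eq_levelSet_add {G : Type*} {s s' x : ℝ} (hs : s < 1) (hs' : 1 ≤ s') (hx : 0 < x)
    (v : ℝ) (φ : G → ℝ≥0∞) (z : G) :
    φ z ^ x = (levelSet s v φ).indicator φ z ^ x + (levelSet s' v φ).indicator φ z ^ x := by
  by_cases h : (2 : ℝ≥0∞) ^ (-v) < φ z
  · have h1 : z ∈ levelSet s v φ := by simpa [levelSet, hs] using h
    have h2 : z ∉ levelSet s' v φ := by simpa [levelSet, not_lt.2 hs'] using h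
    simp [h1, h2, hx]
  · have h1 : z ∉ levelSet s v φ := by simpa [levelSet, hs] using h
    have h2 : z ∈ levelSet s' v φ := by simpa [levelSet, not_lt.2 hs'] using h
    simp [h1, h2, hx]

theorem ofReal_two_rpow_neg_le_one (l : ℕ) : ENNReal.ofReal ((2 : ℝ) ^ (-(l : ℝ))) ≤ 1 := by
  rw [ENNReal.ofReal_le_one]
  exact Real.rpow_le_one_of_one_le_of_nonpos one_le_two (by simp)

/-- The sum over all scales, for normalised functions. -/
theorem exists_tsum_setForm_le_of_lintegral_le_one {x y : ℝ} (hx0 : 0 < x) (hx : x < 1)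
    (hy0 : 0 < y) (hy : y < 1) (hxy : 1 < x + y) :
    ∃ τ : ℝ, 0 < τ ∧ ∀ n : ℕ, 2 ≤ n → ∃ C : ℝ≥0, ∀ l : ℕ,
      ∀ φ ψ : SpaceTime n → ℝ≥0∞, Measurable φ → Measurable ψ → ∫⁻ z, φ z ≤ 1 → ∫⁻ z, ψ z ≤ 1 →
        ∑' j : ℤ, (2 : ℝ≥0∞) ^ (-(2 - x - y) * (((n + 1 : ℕ) : ℝ) * j + -(l : ℝ))) *
          setForm volume (truncatedCone n l j) (fun z => φ z ^ x) (fun z => ψ z ^ y) ≤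
        C * ENNReal.ofReal (2 ^ (-(l : ℝ))) ^ τ := by
  -- The perturbed exponents are `x ± ω` and `y ± ω`; all four pairs must stay below 1 in each entry
  -- and above 1 in sum, the last bound being for `(x - ω) + (y - ω)`.
  obtain ⟨ω, hω, h1, h2, h3, h4, h5⟩ : ∃ ω : ℝ, 0 < ω ∧ ω < x ∧ ω < y ∧ ω < 1 - x ∧ ω < 1 - y ∧
      ω < (x + y - 1) / 2 := by
    obtain ⟨ω, hω, h⟩ := exists_between
      (a₁ := (0 : ℝ)) (a₂ := min x (min y (min (1 - x) (min (1 - y) ((x + y - 1) / 2)))))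
      (by refine lt_min hx0 (lt_min hy0 (lt_min ?_ (lt_min ?_ ?_))) <;> linarith)
    simp only [lt_min_iff] at h
    exact ⟨ω, hω, h⟩
  have hlow {u : ℝ} (hu : 0 < u) : 0 < u / (u + ω) ∧ u / (u + ω) < 1 ∧ u / (u / (u + ω)) = u + ω := by
    refine ⟨by positivity, ?_, by field_simp⟩
    rw [div_lt_one (by positivity)]
    linarith
  have hhigh {u : ℝ} (hu : 0 < u) (huω : ω < u) :
      0 < u / (u - ω) ∧ 1 < u / (u - ω) ∧ u / (u / (u - ω)) = u - ω := by
    have h : 0 < u - ω := by linarith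
    refine ⟨by positivity, ?_, by field_simp⟩
    rw [one_lt_div h]
    linarith
  obtain ⟨a1, a2, a3⟩ := hlow hx0
  obtain ⟨b1, b2, b3⟩ := hhigh hx0 h1
  obtain ⟨c1, c2, c3⟩ := hlow hy0
  obtain ⟨d1, d2, d3⟩ := hhigh hy0 h2
  set s := x / (x + ω)
  set s' := x / (x - ω)
  set t := y / (y + ω)
  set t' := y / (y - ω)
  obtain ⟨τ₁, hτ₁, H₁⟩ := exists_tsum_setForm_levelSet_le hx0 hy0 a1 a2.ne c1 c2.ne
    (by linarith) (by linarith) (by linarith)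
  obtain ⟨τ₂, hτ₂, H₂⟩ := exists_tsum_setForm_levelSet_le hx0 hy0 a1 a2.ne d1 d2.ne'
    (by linarith) (by linarith) (by linarith)
  obtain ⟨τ₃, hτ₃, H₃⟩ := exists_tsum_setForm_levelSet_le hx0 hy0 b1 b2.ne' c1 c2.ne
    (by linarith) (by linarith) (by linarith)
  obtain ⟨τ₄, hτ₄, H₄⟩ := exists_tsum_setForm_levelSet_le hx0 hy0 b1 b2.ne' d1 d2.ne'
    (by linarith) (by linarith) (by linarith)
  refine ⟨min (min τ₁ τ₂) (min τ₃ τ₄), lt_min (lt_min hτ₁ hτ₂) (lt_min hτ₃ hτ₄), fun n hn => ?_⟩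
  obtain ⟨C₁, hC₁⟩ := H₁ n hn
  obtain ⟨C₂, hC₂⟩ := H₂ n hn
  obtain ⟨C₃, hC₃⟩ := H₃ n hn
  obtain ⟨C₄, hC₄⟩ := H₄ n hn
  refine ⟨C₁ + C₂ + (C₃ + C₄), fun l φ ψ hφ hψ hφ1 hψ1 => ?_⟩
  have hm {θ : SpaceTime n → ℝ≥0∞} (hθ : Measurable θ) (r v w : ℝ) :
      Measurable fun z => (levelSet r v θ).indicator θ z ^ w :=
    (hθ.indicator (measurableSet_levelSet hθ _ _)).pow_const _
  let X : ℝ → ℝ → ℤ → ℝ≥0∞ := fun a b j =>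
    (2 : ℝ≥0∞) ^ (-(2 - x - y) * (((n + 1 : ℕ) : ℝ) * j + -(l : ℝ))) *
      setForm volume (truncatedCone n l j)
        (fun z => (levelSet a (((n + 1 : ℕ) : ℝ) * j + -(l : ℝ)) φ).indicator φ z ^ x)
        (fun z => (levelSet b (((n + 1 : ℕ) : ℝ) * j + -(l : ℝ)) ψ).indicator ψ z ^ y)
  have hsplit (j : ℤ) : (2 : ℝ≥0∞) ^ (-(2 - x - y) * (((n + 1 : ℕ) : ℝ) * j + -(l : ℝ))) *
      setForm volume (truncatedCone n l j) (fun z => φ z ^ x) (fun z => ψ z ^ y) =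
        X s t j + X s t' j + (X s' t j + X s' t' j) := by
    have hψ2 : Measurable fun z =>
        (levelSet t (((n + 1 : ℕ) : ℝ) * j + -(l : ℝ)) ψ).indicator ψ z ^ y +
          (levelSet t' (((n + 1 : ℕ) : ℝ) * j + -(l : ℝ)) ψ).indicator ψ z ^ y :=
      (hm hψ _ _ _).add (hm hψ _ _ _)
    rw [funext (rpow_eq_levelSet_add a2 b2.le hx0 (((n + 1 : ℕ) : ℝ) * j + -(l : ℝ)) φ),
      funext (rpow_eq_levelSet_add c2 d2.le hy0 (((n + 1 : ℕ) : ℝ) * j + -(l : ℝ)) ψ),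
      setForm_add_left (hm hφ _ _ _) hψ2,
      setForm_add_right (hm hφ _ _ _) (hm hψ _ _ _),
      setForm_add_right (hm hφ _ _ _) (hm hψ _ _ _)]
    simp only [X]
    generalize (2 : ℝ≥0∞) ^ (-(2 - x - y) * (((n + 1 : ℕ) : ℝ) * j + -(l : ℝ))) = A
    ring
  rw [tsum_congr hsplit, ENNReal.tsum_add, ENNReal.tsum_add, ENNReal.tsum_add]
  have hD := ofReal_two_rpow_neg_le_one l
  set D := ENNReal.ofReal ((2 : ℝ) ^ (-(l : ℝ)))
  push_cast
  simp only [add_mul]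
  refine add_le_add (add_le_add ?_ ?_) (add_le_add ?_ ?_)
  · refine (hC₁ l φ ψ hφ hψ hφ1 hψ1).trans (mul_le_mul_right ?_ _)
    exact ENNReal.rpow_le_rpow_of_exponent_ge hD ((min_le_left _ _).trans (min_le_left _ _))
  · refine (hC₂ l φ ψ hφ hψ hφ1 hψ1).trans (mul_le_mul_right ?_ _)
    exact ENNReal.rpow_le_rpow_of_exponent_ge hD ((min_le_left _ _).trans (min_le_right _ _))
  · refine (hC₃ l φ ψ hφ hψ hφ1 hψ1).trans (mul_le_mul_right ?_ _)
    exact ENNReal.rpow_le_rpow_of_exponent_ge hD ((min_le_right _ _).trans (min_le_left _ _))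
  · refine (hC₄ l φ ψ hφ hψ hφ1 hψ1).trans (mul_le_mul_right ?_ _)
    exact ENNReal.rpow_le_rpow_of_exponent_ge hD ((min_le_right _ _).trans (min_le_right _ _))

/-- Homogeneity removes the normalisation. When an integral vanishes, dividing by it is impossible,
and the single-shell bound shows that every term is zero. -/
theorem exists_tsum_setForm_le {x y : ℝ} (hx0 : 0 < x) (hx : x < 1)
    (hy0 : 0 < y) (hy : y < 1) (hxy : 1 < x + y) :
    ∃ τ : ℝ, 0 < τ ∧ ∀ n : ℕ, 2 ≤ n → ∃ C : ℝ≥0, ∀ l : ℕ,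
      ∀ φ ψ : SpaceTime n → ℝ≥0∞, Measurable φ → Measurable ψ →
        ∑' j : ℤ, (2 : ℝ≥0∞) ^ (-(2 - x - y) * (((n + 1 : ℕ) : ℝ) * j + -(l : ℝ))) *
          setForm volume (truncatedCone n l j) (fun z => φ z ^ x) (fun z => ψ z ^ y) ≤
        C * ENNReal.ofReal (2 ^ (-(l : ℝ))) ^ τ * (∫⁻ z, φ z) ^ x * (∫⁻ z, ψ z) ^ y := by
  obtain ⟨τ, hτ, H⟩ := exists_tsum_setForm_le_of_lintegral_le_one hx0 hx hy0 hy hxy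
  refine ⟨τ, hτ, fun n hn => ?_⟩
  obtain ⟨C, hC⟩ := H n hn
  -- A nonzero constant avoids `0 * ∞ = 0` when one of the integrals is infinite.
  refine ⟨C + 1, fun l φ ψ hφ hψ => ?_⟩
  set I := ∫⁻ z, φ z with hI
  set J := ∫⁻ z, ψ z with hJ
  by_cases h0 : I = 0 ∨ J = 0
  · obtain ⟨σ, -, hσ⟩ := exists_setForm_coneShell_le hx hy hxy
    obtain ⟨C', hC'⟩ := hσ n hn
    have hz (j : ℤ) : setForm volume (truncatedCone n l j) (fun z => φ z ^ x)
        (fun z => ψ z ^ y) = 0 := by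
      rw [truncatedCone_eq_coneShell]
      refine le_antisymm ((hC' ((2 : ℝ) ^ j) (2 ^ (-(l : ℝ))) (by positivity) (by positivity)
        (Real.rpow_le_one_of_one_le_of_nonpos one_le_two (by simp)) φ ψ hφ hψ).trans ?_) zero_le
      rw [← hI, ← hJ]
      rcases h0 with h | h
      · simp [h, ENNReal.zero_rpow_of_pos hx0]
      · simp [h, ENNReal.zero_rpow_of_pos hy0]
    simp [hz]
  push Not at h0
  obtain ⟨hI0, hJ0⟩ := h0
  have hIx : I ^ x ≠ 0 := by simp [hI0, not_lt.2 hx0.le]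
  have hJy : J ^ y ≠ 0 := by simp [hJ0, not_lt.2 hy0.le]
  rcases eq_or_ne I ∞ with hIt | hIt
  · rw [hIt, ENNReal.top_rpow_of_pos hx0, ENNReal.mul_top (by simp), ENNReal.top_mul hJy]
    exact le_top
  rcases eq_or_ne J ∞ with hJt | hJt
  · rw [hJt, ENNReal.top_rpow_of_pos hy0, ENNReal.mul_top (by simp [hIx])]
    exact le_top
  have hmain := hC l (fun z => I⁻¹ * φ z) (fun z => J⁻¹ * ψ z) (hφ.const_mul _) (hψ.const_mul _)
    (by rw [lintegral_const_mul _ hφ, ENNReal.inv_mul_cancel hI0 hIt])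
    (by rw [lintegral_const_mul _ hψ, ENNReal.inv_mul_cancel hJ0 hJt])
  have hscale (j : ℤ) : setForm volume (truncatedCone n l j) (fun z => φ z ^ x)
      (fun z => ψ z ^ y) = I ^ x * J ^ y * setForm volume (truncatedCone n l j)
        (fun z => (I⁻¹ * φ z) ^ x) (fun z => (J⁻¹ * ψ z) ^ y) := by
    rw [← setForm_const_mul ((hφ.const_mul _).pow_const _) ((hψ.const_mul _).pow_const _)]
    simp_rw [← ENNReal.mul_rpow_of_nonneg _ _ hx0.le, ← ENNReal.mul_rpow_of_nonneg _ _ hy0.le,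
      ← mul_assoc, ENNReal.mul_inv_cancel hI0 hIt, ENNReal.mul_inv_cancel hJ0 hJt, one_mul]
  simp_rw [hscale, mul_left_comm _ (I ^ x * J ^ y)]
  rw [ENNReal.tsum_mul_left]
  calc _ ≤ I ^ x * J ^ y * (C * ENNReal.ofReal (2 ^ (-(l : ℝ))) ^ τ) := by gcongr
    _ ≤ I ^ x * J ^ y * (((C + 1 : ℝ≥0) : ℝ≥0∞) * ENNReal.ofReal (2 ^ (-(l : ℝ))) ^ τ) := by
        gcongr
        simp
    _ = _ := by ring

/-! ### From shells to the partial operators -/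

theorem measurableSet_truncatedCone (n l : ℕ) (j : ℤ) : MeasurableSet (truncatedCone n l j) := by
  rw [truncatedCone_eq_coneShell]
  exact measurableSet_coneShell _ _ _

/-- Because `n - α = n (1 - α / n)`, the two factors combine to a single power of `2 ^ ((n + 1) j -
l)`, the volume scale of the truncated cone. -/
theorem kernel_le {n l : ℕ} (hn : 0 < n) {j : ℤ} {α : ℝ} (hα : α / n ≤ 1) {w : SpaceTime n}
    (hw : w ∈ truncatedCone n l j) :
    ENNReal.ofReal (kernel n α w) ≤
      2 ^ (-(1 - α / n) * (((n + 1 : ℕ) : ℝ) * j + -(l : ℝ))) := by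
  rw [truncatedCone_eq_coneShell] at hw
  obtain ⟨-, h1, -, h2, -⟩ := hw
  have hn' : (0 : ℝ) < n := by exact_mod_cast hn
  have hb : (0 : ℝ) < (2 : ℝ) ^ j * 2 ^ (-(l : ℝ)) := by positivity
  have e0 : (n : ℝ) - α = n * (1 - α / n) := by field_simp
  have hexp : 0 ≤ 1 - α / n := by linarith
  have k1 : (1 / (|w.2| + ‖w.1‖)) ^ ((n : ℝ) - α) ≤ (2 : ℝ) ^ (-(1 - α / n) * (n * j)) := by
    rw [one_div, Real.inv_rpow (by positivity), e0]
    calc ((|w.2| + ‖w.1‖) ^ ((n : ℝ) * (1 - α / n)))⁻¹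
        ≤ (((2 : ℝ) ^ j) ^ ((n : ℝ) * (1 - α / n)))⁻¹ := by gcongr
      _ = _ := by
        rw [← Real.rpow_intCast, ← Real.rpow_mul two_pos.le, ← Real.rpow_neg two_pos.le]
        congr 1
        ring
  have k2 : (1 / (|w.2| - ‖w.1‖)) ^ (1 - α / n) ≤ (2 : ℝ) ^ (-(1 - α / n) * (j + -(l : ℝ))) := by
    rw [one_div, Real.inv_rpow (hb.le.trans h2)]
    calc ((|w.2| - ‖w.1‖) ^ (1 - α / n))⁻¹
        ≤ (((2 : ℝ) ^ j * 2 ^ (-(l : ℝ))) ^ (1 - α / n))⁻¹ := by gcongr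
      _ = _ := by
        rw [← Real.rpow_intCast, ← Real.rpow_add two_pos, ← Real.rpow_mul two_pos.le,
          ← Real.rpow_neg two_pos.le]
        congr 1
        ring
  rw [← ENNReal.ofReal_ofNat, ENNReal.ofReal_rpow_of_pos two_pos]
  refine ENNReal.ofReal_le_ofReal ?_
  calc kernel n α w ≤ (2 : ℝ) ^ (-(1 - α / n) * (n * j)) * 2 ^ (-(1 - α / n) * (j + -(l : ℝ))) := by
        unfold kernel
        have : 0 ≤ |w.2| - ‖w.1‖ := hb.le.trans h2
        gcongr
    _ = _ := by
        rw [← Real.rpow_add two_pos]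
        congr 1
        push_cast
        ring

theorem partialOp_le_tsum {n : ℕ} (hn : 0 < n) {α : ℝ} (hα : α / n ≤ 1) (l : ℕ)
    (f : SpaceTime n → ℝ≥0∞) (z : SpaceTime n) :
    partialOp n α l f z ≤ ∑' j : ℤ, (2 : ℝ≥0∞) ^ (-(1 - α / n) *
      (((n + 1 : ℕ) : ℝ) * j + -(l : ℝ))) * ∫⁻ w in truncatedCone n l j, f (z - w) := by
  refine (lintegral_iUnion_le _ _).trans (ENNReal.tsum_le_tsum fun j => ?_)
  rw [← lintegral_const_mul' _ _ (ENNReal.rpow_ne_top_of_ne_zero two_ne_zero ENNReal.ofNat_ne_top)]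
  refine setLIntegral_mono' (measurableSet_truncatedCone n l j) fun w hw => ?_
  rw [mul_comm]
  exact mul_le_mul_left (kernel_le hn hα hw) _

theorem measurable_kernel (n : ℕ) (α : ℝ) : Measurable (kernel n α) := by
  unfold kernel
  fun_prop

theorem measurable_partialOp {n : ℕ} {α : ℝ} {l : ℕ} {f : SpaceTime n → ℝ≥0∞}
    (hf : Measurable f) : Measurable (partialOp n α l f) :=
  Measurable.lintegral_prod_right' (f := fun q : SpaceTime n × SpaceTime n =>
    f (q.1 - q.2) * ENNReal.ofReal (kernel n α q.2))
    ((measurable_comp_sub hf).mul ((measurable_kernel n α).comp measurable_snd).ennreal_ofReal)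

/-- The bilinear estimate for the partial operators, with decay in the eccentricity. -/
theorem exists_lintegral_partialOp_mul_le {x y : ℝ} (hx0 : 0 < x) (hx : x < 1)
    (hy0 : 0 < y) (hy : y < 1) (hxy : 1 < x + y) :
    ∃ τ : ℝ, 0 < τ ∧ ∀ n : ℕ, 2 ≤ n → ∃ C : ℝ≥0, ∀ (α : ℝ), α / n = x + y - 1 → ∀ l : ℕ,
      ∀ f g : SpaceTime n → ℝ≥0∞, Measurable f → Measurable g →
        ∫⁻ z, partialOp n α l f z * g z ≤ C * ENNReal.ofReal (2 ^ (-(l : ℝ))) ^ τ *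
          (∫⁻ z, f z ^ x⁻¹) ^ x * (∫⁻ z, g z ^ y⁻¹) ^ y := by
  obtain ⟨τ, hτ, H⟩ := exists_tsum_setForm_le hx0 hx hy0 hy hxy
  refine ⟨τ, hτ, fun n hn => ?_⟩
  obtain ⟨C, hC⟩ := H n hn
  refine ⟨C, fun α hα l f g hf hg => ?_⟩
  have h := hC l (fun z => f z ^ x⁻¹) (fun z => g z ^ y⁻¹) (hf.pow_const _) (hg.pow_const _)
  simp_rw [ENNReal.rpow_inv_rpow hx0.ne', ENNReal.rpow_inv_rpow hy0.ne'] at h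
  refine le_trans ?_ h
  have e : 1 - α / n = 2 - x - y := by linarith
  have hm (j : ℤ) : Measurable fun z => g z * ∫⁻ w in truncatedCone n l j, f (z - w) :=
    hg.mul (measurable_setLIntegral_sub hf _)
  calc ∫⁻ z, partialOp n α l f z * g z
      ≤ ∫⁻ z, ∑' j : ℤ, (2 : ℝ≥0∞) ^ (-(2 - x - y) * (((n + 1 : ℕ) : ℝ) * j + -(l : ℝ))) *
        (g z * ∫⁻ w in truncatedCone n l j, f (z - w)) := by
        refine lintegral_mono fun z => ?_
        refine (mul_le_mul_left (partialOp_le_tsum (by omega) (by linarith) l f z) _).trans ?_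
        rw [e, ← ENNReal.tsum_mul_right]
        refine le_of_eq (tsum_congr fun j => ?_)
        ring
    _ = _ := by
        rw [lintegral_tsum fun j => ((hm j).const_mul _).aemeasurable]
        exact tsum_congr fun j => lintegral_const_mul _ (hm j)

/-! ### Duality and the final summation -/

/-- A converse of Hölder's inequality. -/
theorem lintegral_rpow_le_of_forall_lintegral_mul_le {G : Type*} [MeasurableSpace G]
    {μ : Measure G} [SigmaFinite μ] {q : ℝ} (hq : 1 < q) {U : G → ℝ≥0∞} (hU : Measurable U)
    {B : ℝ≥0∞} (h : ∀ g : G → ℝ≥0∞, Measurable g →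
      ∫⁻ z, U z * g z ∂μ ≤ B * (∫⁻ z, g z ^ (1 - q⁻¹)⁻¹ ∂μ) ^ (1 - q⁻¹)) :
    ∫⁻ z, U z ^ q ∂μ ≤ B ^ q := by
  have hq0 : 0 < q := by linarith
  have hq1 : q⁻¹ < 1 := inv_lt_one_of_one_lt₀ hq
  -- Truncation in space and height makes the `q`-th moment finite, so that it may be divided out
  -- after testing against `W k ^ (q - 1)`.
  let W : ℕ → G → ℝ≥0∞ := fun k => (spanningSets μ k).indicator fun z => min (U z) k
  have hW (k : ℕ) : Measurable (W k) :=
    (hU.min measurable_const).indicator (measurableSet_spanningSets μ k)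
  have hWU (k : ℕ) (z : G) : W k z ≤ U z :=
    (Set.indicator_le_self' (fun _ _ => zero_le) z).trans (min_le_left _ _)
  have hbound (k : ℕ) : ∫⁻ z, W k z ^ q ∂μ ≤ B ^ q := by
    set M := ∫⁻ z, W k z ^ q ∂μ with hM
    have hMtop : M ≠ ∞ := by
      have h1 : M ≤ ∫⁻ z, (spanningSets μ k).indicator (fun _ => (k : ℝ≥0∞) ^ q) z ∂μ := by
        refine lintegral_mono fun z => ?_
        by_cases hz : z ∈ spanningSets μ k
        · simp only [W, Set.indicator_of_mem hz]
          gcongr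
          exact min_le_right _ _
        · simp [W, Set.indicator_of_notMem hz, hq0]
      refine ne_top_of_le_ne_top ?_ h1
      rw [lintegral_indicator_const (measurableSet_spanningSets μ k)]
      exact ENNReal.mul_ne_top (ENNReal.rpow_ne_top_of_nonneg hq0.le (ENNReal.natCast_ne_top k))
        (measure_spanningSets_lt_top μ k).ne
    rcases eq_or_ne M 0 with h0 | h0
    · rw [h0]
      exact zero_le
    have h1 := h (fun z => W k z ^ (q - 1)) ((hW k).pow_const _)
    have e1 : (q - 1) * (1 - q⁻¹)⁻¹ = q := by
      have : q - 1 ≠ 0 := by linarith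
      field_simp
    simp_rw [← ENNReal.rpow_mul, e1] at h1
    have h2 : M ≤ B * M ^ (1 - q⁻¹) := by
      refine le_trans (lintegral_mono fun z => ?_) h1
      have e2 : q = 1 + (q - 1) := by ring
      calc W k z ^ q = W k z * W k z ^ (q - 1) := by
            conv_lhs => rw [e2, ENNReal.rpow_add_of_nonneg _ _ zero_le_one (by linarith),
              ENNReal.rpow_one]
        _ ≤ _ := by gcongr; exact hWU k z
    have h3 : M ^ q⁻¹ ≤ B := by
      have h4 : M ^ q⁻¹ * M ^ (1 - q⁻¹) ≤ B * M ^ (1 - q⁻¹) := by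
        rw [← ENNReal.rpow_add _ _ h0 hMtop, add_sub_cancel, ENNReal.rpow_one]
        exact h2
      refine (ENNReal.mul_le_mul_iff_left ?_ ?_).1 h4
      · exact (ENNReal.rpow_pos (pos_iff_ne_zero.2 h0) hMtop).ne'
      · exact ENNReal.rpow_ne_top_of_nonneg (by linarith) hMtop
    calc M = (M ^ q⁻¹) ^ q := (ENNReal.rpow_inv_rpow hq0.ne' M).symm
      _ ≤ B ^ q := by gcongr
  have hmono : Monotone W := by
    intro k m hkm z
    by_cases hz : z ∈ spanningSets μ k
    · have hz' : z ∈ spanningSets μ m := monotone_spanningSets μ hkm hz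
      simp only [W, Set.indicator_of_mem hz, Set.indicator_of_mem hz']
      gcongr
    · simp [W, Set.indicator_of_notMem hz]
  have hsup (z : G) : U z ^ q ≤ ⨆ k, W k z ^ q := by
    have hU' : U z ≤ ⨆ k, W k z := by
      refine le_of_forall_lt fun c hc => ?_
      obtain ⟨k₁, hk₁⟩ := ENNReal.exists_nat_gt (ne_top_of_lt hc)
      obtain ⟨k₂, hk₂⟩ : ∃ k, z ∈ spanningSets μ k := by
        have := Set.mem_univ z
        rwa [← iUnion_spanningSets μ, Set.mem_iUnion] at this
      refine lt_of_lt_of_le ?_ (le_iSup (fun k => W k z) (max k₁ k₂))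
      have hz : z ∈ spanningSets μ (max k₁ k₂) := monotone_spanningSets μ (le_max_right _ _) hk₂
      simp only [W, Set.indicator_of_mem hz]
      exact lt_min hc (hk₁.trans_le (by exact_mod_cast le_max_left _ _))
    calc U z ^ q ≤ (⨆ k, W k z) ^ q := by gcongr
      _ = _ := (ENNReal.orderIsoRpow q hq0).map_iSup _
  calc ∫⁻ z, U z ^ q ∂μ ≤ ∫⁻ z, ⨆ k, W k z ^ q ∂μ := lintegral_mono hsup
    _ = ⨆ k, ∫⁻ z, W k z ^ q ∂μ := by
      refine lintegral_iSup (fun k => (hW k).pow_const _) fun k m hkm z => ?_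
      exact ENNReal.rpow_le_rpow (hmono hkm z) hq0.le
    _ ≤ B ^ q := iSup_le hbound

theorem partialOp_congr_ae {n : ℕ} {α : ℝ} {l : ℕ} {f g : SpaceTime n → ℝ≥0∞}
    (h : f =ᵐ[volume] g) : partialOp n α l f = partialOp n α l g := by
  funext z
  refine lintegral_congr_ae (ae_restrict_of_ae ?_)
  have hz := (Measure.measurePreserving_sub_left (volume : Measure (SpaceTime n))
    z).quasiMeasurePreserving.ae_eq_comp h
  filter_upwards [hz] with w hw
  have hw' : f (z - w) = g (z - w) := hw
  simp only [← Prod.fst_sub, ← Prod.snd_sub, Prod.mk.eta, hw']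

theorem tsum_Ici_ofReal_two_rpow_le {τ : ℝ} (hτ : 0 < τ) :
    ∃ K : ℝ≥0, ∀ h : ℕ, ∑' l : Set.Ici h, ENNReal.ofReal (2 ^ (-((l : ℕ) : ℝ))) ^ τ ≤
      K * ENNReal.ofReal ((2 : ℝ) ^ (-(τ * (h : ℝ)))) := by
  have hconv (l : ℕ) : ENNReal.ofReal ((2 : ℝ) ^ (-(l : ℝ))) ^ τ = 2 ^ (-(τ * (l : ℝ))) := by
    rw [← ENNReal.ofReal_rpow_of_pos two_pos, ENNReal.ofReal_ofNat, ← ENNReal.rpow_mul]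
    congr 1
    ring
  refine ⟨(∑' j : ℤ, (2 : ℝ≥0∞) ^ (-τ * |(j : ℝ)|)).toNNReal, fun h => ?_⟩
  rw [ENNReal.coe_toNNReal (tsum_two_rpow_abs_lt_top hτ).ne,
    ← ENNReal.ofReal_rpow_of_pos two_pos, ENNReal.ofReal_ofNat, ← ENNReal.tsum_mul_right]
  let e : Set.Ici h → ℤ := fun l => (l : ℕ) - (h : ℤ)
  have he : Function.Injective e := by
    intro a b hab
    simp only [e] at hab
    exact Subtype.ext (by omega)
  refine le_trans (le_of_eq (tsum_congr fun l => ?_)) (ENNReal.tsum_comp_le_tsum_of_injective he _)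
  rw [hconv, ← two_rpow_add]
  congr 1
  have hl : (h : ℝ) ≤ ((l : ℕ) : ℝ) := by exact_mod_cast l.2
  have e1 : ((e l : ℤ) : ℝ) = ((l : ℕ) : ℝ) - h := by simp [e]
  rw [e1, abs_of_nonneg (by linarith)]
  ring

end LightCone

theorem mainTheorem2 (θ : ℝ) (hθ : 0 < θ) :
    ∃ q₀ : ℕ, ∀ (q : ℕ) (p : ℝ), q₀ ≤ q → 1 < p → p < (q : ℝ) →
      θ ≤ 1 / p - 1 / (q : ℝ) →
      ∃ ε : ℝ, 0 < ε ∧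
        ∀ (n : ℕ) (α : ℝ), 2 ≤ n → α / (n : ℝ) = 1 / p - 1 / (q : ℝ) →
          ∃ C : ℝ≥0, ∀ f : LightCone.SpaceTime n → ℝ≥0∞, AEMeasurable f volume →
            ∀ h : ℕ,
              ∫⁻ z : LightCone.SpaceTime n, ∑' ℓ : Set.Ici h,
                  LightCone.partialOp n α (ℓ : ℕ) f z *
                    (LightCone.partialOp n α ((ℓ : ℕ) - h) f z) ^ (q - 1)
                ≤ (C : ℝ≥0∞) * ENNReal.ofReal ((2 : ℝ) ^ (-(ε * (h : ℝ)))) *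
                    eLpNorm f (ENNReal.ofReal p) volume ^ q := by
  -- Every `q` is admissible; `p < q` already ensures `1 < 1/p + (1 - 1/q)`, and the decay rate is
  -- that of the bilinear estimate.
  refine ⟨0, fun q p _ hp hpq hθq => ?_⟩
  have hp0 : 0 < p := by linarith
  have hq0 : (0 : ℝ) < q := by linarith
  have hq1 : (1 : ℝ) < q := by linarith
  have hqn : 1 < q := by exact_mod_cast hq1
  rw [one_div, one_div] at hθq
  have hp1 : p⁻¹ < 1 := inv_lt_one_of_one_lt₀ hp
  have hq' : (q : ℝ)⁻¹ < 1 := inv_lt_one_of_one_lt₀ hq1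
  have hp2 : 0 < p⁻¹ := by positivity
  have hq2 : 0 < (q : ℝ)⁻¹ := by positivity
  obtain ⟨τ, hτ, H⟩ := LightCone.exists_lintegral_partialOp_mul_le hp2 hp1
    (y := 1 - (q : ℝ)⁻¹) (by linarith) (by linarith) (by linarith)
  obtain ⟨K, hK⟩ := LightCone.tsum_Ici_ofReal_two_rpow_le hτ
  refine ⟨τ, hτ, fun n α hn hα => ?_⟩
  obtain ⟨C, hC⟩ := H n hn
  have hα' : α / n = p⁻¹ + (1 - (q : ℝ)⁻¹) - 1 := by
    rw [hα, one_div, one_div]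
    ring
  replace hC := hC α hα'
  refine ⟨C ^ q * K, fun f hf h => ?_⟩
  obtain ⟨f', hf', hff'⟩ : ∃ f', Measurable f' ∧ f =ᵐ[volume] f' :=
    ⟨hf.mk f, hf.measurable_mk, hf.ae_eq_mk⟩
  rw [eLpNorm_congr_ae hff']
  simp_rw [LightCone.partialOp_congr_ae hff']
  have hnorm : eLpNorm f' (ENNReal.ofReal p) volume = (∫⁻ z, f' z ^ (p⁻¹)⁻¹) ^ p⁻¹ := by
    rw [eLpNorm_eq_lintegral_rpow_enorm_toReal (by simpa using hp0) ENNReal.ofReal_ne_top,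
      ENNReal.toReal_ofReal hp0.le]
    simp
  rw [hnorm]
  set N := (∫⁻ z, f' z ^ (p⁻¹)⁻¹) ^ p⁻¹
  have hU (l : ℕ) : Measurable (LightCone.partialOp n α l f') := LightCone.measurable_partialOp hf'
  -- This is the L^p → L^q bound for the factors of index `ℓ - h`. Their decay is discarded, since
  -- the factor of index `ℓ` alone supplies `2 ^ (-τℓ)`.
  have hstrong (l : ℕ) : ∫⁻ z, LightCone.partialOp n α l f' z ^ (q : ℝ) ≤ (C * N) ^ (q : ℝ) := by
    refine LightCone.lintegral_rpow_le_of_forall_lintegral_mul_le hq1 (hU l) fun g hg => ?_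
    refine (hC l f' g hf' hg).trans ?_
    gcongr
    calc C * ENNReal.ofReal (2 ^ (-(l : ℝ))) ^ τ ≤ C * 1 := by
          gcongr
          exact ENNReal.rpow_le_one (LightCone.ofReal_two_rpow_neg_le_one l) hτ.le
      _ = C := mul_one _
  have hterm (l : Set.Ici h) : ∫⁻ z, LightCone.partialOp n α (l : ℕ) f' z *
      LightCone.partialOp n α ((l : ℕ) - h) f' z ^ (q - 1) ≤
      C ^ q * N ^ q * ENNReal.ofReal (2 ^ (-((l : ℕ) : ℝ))) ^ τ := by
    refine (hC l f' _ hf' ((hU _).pow_const _)).trans ?_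
    have e1 : ((q - 1 : ℕ) : ℝ) * (1 - (q : ℝ)⁻¹)⁻¹ = q := by
      rw [Nat.cast_sub hqn.le, Nat.cast_one]
      have : (q : ℝ) - 1 ≠ 0 := by linarith
      field_simp
    have e2 : (q : ℝ) * (1 - (q : ℝ)⁻¹) = ((q - 1 : ℕ) : ℝ) := by
      rw [Nat.cast_sub hqn.le, Nat.cast_one]
      field_simp
    simp_rw [← ENNReal.rpow_natCast (_ : ℝ≥0∞) (q - 1), ← ENNReal.rpow_mul, e1]
    calc _ ≤ C * ENNReal.ofReal (2 ^ (-((l : ℕ) : ℝ))) ^ τ * N *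
          ((C * N) ^ (q : ℝ)) ^ (1 - (q : ℝ)⁻¹) := by
          have : 0 ≤ 1 - (q : ℝ)⁻¹ := by linarith
          gcongr
          exact hstrong _
      _ = C * ENNReal.ofReal (2 ^ (-((l : ℕ) : ℝ))) ^ τ * N * (C * N) ^ (q - 1) := by
          rw [← ENNReal.rpow_mul, e2, ENNReal.rpow_natCast]
      _ = (C * N) ^ (q - 1 + 1) * ENNReal.ofReal (2 ^ (-((l : ℕ) : ℝ))) ^ τ := by ring
      _ = _ := by rw [Nat.sub_add_cancel hqn.le, mul_pow]
  have hprod (l : Set.Ici h) : Measurable fun z => LightCone.partialOp n α (l : ℕ) f' z *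
      LightCone.partialOp n α ((l : ℕ) - h) f' z ^ (q - 1) :=
    (hU _).mul ((hU _).pow_const _)
  rw [lintegral_tsum fun l => (hprod l).aemeasurable]
  calc _ ≤ ∑' l : Set.Ici h, C ^ q * N ^ q * ENNReal.ofReal (2 ^ (-((l : ℕ) : ℝ))) ^ τ :=
        ENNReal.tsum_le_tsum hterm
    _ = C ^ q * N ^ q * ∑' l : Set.Ici h, ENNReal.ofReal (2 ^ (-((l : ℕ) : ℝ))) ^ τ :=
        ENNReal.tsum_mul_left
    _ ≤ C ^ q * N ^ q * (K * ENNReal.ofReal ((2 : ℝ) ^ (-(τ * (h : ℝ))))) := by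
        gcongr
        exact hK h
    _ = _ := by
        push_cast
        ring
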